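/- Let $r,p,n\ge 1$ be integers with $p\mid r$, and let $\xi\in\mathbb C$ be a primitive $p$-th root of unity. Let $V=\mathbb C^n$ with its standard Hermitian inner product and basis $e_1,\dots,e_n$. Groups. $G(r,1,n)\subset U(V)$ is the group of transformations $e_j\mapsto a_je_{\sigma(j)}$ with $\sigma$ a permutation and $a_j^r=1$. Its standard generators are $S_1=\mathrm{diag}(e^{2\pi i/r},1,\dots,1)$ and, for $2\le i\le n$, the transformation $S_i$ which exchanges $e_{i-1}$ and $e_i$. $G(r,p,n)$ is the subgroup generated by $S_1^p$, $S_1^{-1}S_2S_1$ (if $n\ge2$) and $S_2,\dots,S_n$. Cherednik algebras. For a finite group $W\subset U(V)$, a reflection is an element of $W$ whose fixed space is a hyperplane, and $\mathcal A$ is the set of these hyperplanes. For $H\in\mathcal A$ let $W_H$ be the pointwise stabilizer of $H$, let $v_H\neq0$ be a normal vector of $H$, and let $\alpha_H=\langle v_H,\cdot\rangle\in V^*$. For a conjugation-invariant complex function $c$ on the reflections of $W$ put $\gamma_H=\sum_{g\in W_H\setminus\{1\}}c_g\,g$. The rational Cherednik algebra $H_c(W)$ is the $\mathbb C$-algebra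 generated by the vector spaces $V^*$ and $V$ and the group $W$, with the relations (for $x,x'\in V^*$, $y,y'\in V$, $w\in W$) $$[x,x']=0,\quad [y,y']=0,\quad wxw^{-1}=w(x),\quad wyw^{-1}=w(y),$$ $$[y,x]=\langle y,x\rangle+\sum_{H\in\mathcal A}\frac{\langle\alpha_H,y\rangle\langle x,v_H\rangle}{\langle\alpha_H,v_H\rangle}\,\gamma_H .$$ Theorem. Let $c$ be a $G(r,1,n)$-invariant function on the reflections of $G(r,1,n)$ with $c_g=0$ for every reflection $g\in G(r,1,n)\setminus G(r,p,n)$; write $c$ also for its restriction to the reflections of $G(r,p,n)$. Then: (1) There is a unique algebra automorphism $\tau$ of $\mathbb C[G(r,1,n)]$ with $\tau(S_1)=\xi S_1$ and $\tau(S_i)=S_i$ for $2\le i\le n$, and it has order $p$. (2) There is a unique algebra automorphism of $H_c(G(r,1,n))$, again denoted $\tau$, which fixes the images of all $x\in V^*$ and all $y\in V$ and is compatible with the automorphism $\tau$ of (1) along the canonical homomorphism $\mathbb C[G(r,1,n)]\to H_c(G(r,1,n))$. It has order $p$, and so gives an action of $\mathbb Z/p\mathbb Z=\langle\tau\rangle$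 on $H_c(G(r,1,n))$ by algebra automorphisms. (3) There is an injective algebra homomorphism $H_c(G(r,p,n))\to H_c(G(r,1,n))$ which sends the generators $x\in V^*$, $y\in V$, $w\in G(r,p,n)$ to the generators of the same name, and its image is the subalgebra of invariants. In this sense $$H_c(G(r,p,n))=H_c(G(r,1,n))^{\mathbb Z/p\mathbb Z}.$$ -/

import Mathlib

open Complex

noncomputable section

/-! ### Rational Cherednik algebras of finite unitary groups -/

namespace RationalCherednik

section General

variable {V : Type*} [NormedAddCommGroup V] [InnerProductSpace ℂ V]

/-- The space of vectors fixed by a unitary transformation. -/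
def fixedSpace (w : V ≃ₗᵢ[ℂ] V) : Submodule ℂ V :=
  LinearMap.eqLocus (w.toLinearEquiv : V →ₗ[ℂ] V) LinearMap.id

/-- A (complex) reflection: a unitary transformation whose fixed space is a hyperplane. -/
def IsReflection (w : V ≃ₗᵢ[ℂ] V) : Prop :=
  Module.finrank ℂ (fixedSpace w) + 1 = Module.finrank ℂ V

/-- The arrangement `𝒜` of all reflection hyperplanes of `W`. -/
def arrangement (W : Subgroup (V ≃ₗᵢ[ℂ] V)) : Set (Submodule ℂ V) :=
  {H | ∃ s ∈ W, IsReflection s ∧ fixedSpace s = H}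

theorem arrangement_finite (W : Subgroup (V ≃ₗᵢ[ℂ] V)) [Finite W] : (arrangement W).Finite := by
  refine (Set.finite_range (fun w : W => fixedSpace (w : V ≃ₗᵢ[ℂ] V))).subset ?_
  rintro H ⟨s, hs, -, rfl⟩
  exact ⟨⟨s, hs⟩, rfl⟩

/-- The pointwise stabilizer `W_H` of a subspace `H`. -/
def pointStabilizer (W : Subgroup (V ≃ₗᵢ[ℂ] V)) (H : Submodule ℂ V) : Subgroup W where
  carrier := {w | ∀ x ∈ H, (w : V ≃ₗᵢ[ℂ] V) x = x}
  one_mem' := fun _ _ => rfl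
  mul_mem' := by
    intro a b ha hb x hx
    have h1 : ((a * b : W) : V ≃ₗᵢ[ℂ] V) x = (a : V ≃ₗᵢ[ℂ] V) ((b : V ≃ₗᵢ[ℂ] V) x) := rfl
    rw [h1, hb x hx, ha x hx]
  inv_mem' := by
    intro a ha x hx
    have h1 : ((a⁻¹ : W) : V ≃ₗᵢ[ℂ] V) x = (a : V ≃ₗᵢ[ℂ] V).symm x := rfl
    rw [h1, LinearIsometryEquiv.symm_apply_eq, ha x hx]

/-- A normal vector `v_H ≠ 0` of a hyperplane `H`. -/
def normal (H : Submodule ℂ V) : V :=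
  Classical.epsilon fun v => v ∈ Hᗮ ∧ v ≠ 0

theorem normal_spec [FiniteDimensional ℂ V] {H : Submodule ℂ V} (hH : H ≠ ⊤) :
    normal H ∈ Hᗮ ∧ normal H ≠ 0 := by
  refine Classical.epsilon_spec (p := fun v => v ∈ Hᗮ ∧ v ≠ 0) ?_
  exact Submodule.exists_mem_ne_zero_of_ne_bot fun h => hH (Submodule.orthogonal_eq_bot_iff.1 h)

/-- The scalar `⟨α_H, y⟩ ⟨x, v_H⟩ / ⟨α_H, v_H⟩`, where `α_H = v_H^*` is the linear form
`⟪v_H, ·⟫`, with kernel `H`. It does not depend on the choice of `v_H`. -/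
def hyperplaneCoeff (H : Submodule ℂ V) (y : V) (x : Module.Dual ℂ V) : ℂ :=
  inner ℂ (normal H) y * x (normal H) / inner ℂ (normal H) (normal H)

/-- The generators of the Cherednik algebra: `V^*`, `V` and `W`. -/
inductive Gen (W : Subgroup (V ≃ₗᵢ[ℂ] V)) : Type _
  | x (f : Module.Dual ℂ V) : Gen W
  | y (v : V) : Gen W
  | g (w : W) : Gen W

variable (W : Subgroup (V ≃ₗᵢ[ℂ] V)) (c : W → ℂ)

/-- The generator of the free algebra given by `f ∈ V^*`. -/
abbrev fx (f : Module.Dual ℂ V) : FreeAlgebra ℂ (Gen W) := FreeAlgebra.ι ℂ (Gen.x f)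

/-- The generator of the free algebra given by `v ∈ V`. -/
abbrev fy (v : V) : FreeAlgebra ℂ (Gen W) := FreeAlgebra.ι ℂ (Gen.y v)

/-- The generator of the free algebra given by `w ∈ W`. -/
abbrev fg (w : W) : FreeAlgebra ℂ (Gen W) := FreeAlgebra.ι ℂ (Gen.g w)

/-- The element `γ_H = ∑_{g ∈ W_H, g ≠ 1} c_g g`. -/
def gammaElt (H : Submodule ℂ V) : FreeAlgebra ℂ (Gen W) :=
  ∑ᶠ w ∈ {w : W | w ∈ pointStabilizer W H ∧ w ≠ 1}, c w • fg W w

/-- The defining relations of the rational Cherednik algebra. The first six say that `V^*` and `V`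
are embedded linearly and that products in `W` are kept. -/
inductive Rel : FreeAlgebra ℂ (Gen W) → FreeAlgebra ℂ (Gen W) → Prop
  | x_add (f f' : Module.Dual ℂ V) : Rel (fx W (f + f')) (fx W f + fx W f')
  | x_smul (a : ℂ) (f : Module.Dual ℂ V) : Rel (fx W (a • f)) (a • fx W f)
  | y_add (v v' : V) : Rel (fy W (v + v')) (fy W v + fy W v')
  | y_smul (a : ℂ) (v : V) : Rel (fy W (a • v)) (a • fy W v)
  | g_one : Rel (fg W 1) 1
  | g_mul (w w' : W) : Rel (fg W (w * w')) (fg W w * fg W w')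
  | x_comm (f f' : Module.Dual ℂ V) : Rel (fx W f * fx W f') (fx W f' * fx W f)
  | y_comm (v v' : V) : Rel (fy W v * fy W v') (fy W v' * fy W v)
  | g_x (w : W) (f : Module.Dual ℂ V) :
      Rel (fg W w * fx W f * fg W w⁻¹)
        (fx W (f ∘ₗ ((w⁻¹ : W) : V ≃ₗᵢ[ℂ] V).toLinearEquiv.toLinearMap))
  | g_y (w : W) (v : V) :
      Rel (fg W w * fy W v * fg W w⁻¹) (fy W ((w : V ≃ₗᵢ[ℂ] V) v))
  | y_x (v : V) (f : Module.Dual ℂ V) :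
      Rel (fy W v * fx W f - fx W f * fy W v)
        (algebraMap ℂ _ (f v) + ∑ᶠ H ∈ arrangement W, hyperplaneCoeff H v f • gammaElt W c H)

/-- The rational Cherednik algebra `H_c(W)` of a finite group `W` of unitary transformations.
Only the values of `c` at the reflections of `W` enter. -/
def CherednikAlgebra [FiniteDimensional ℂ V] [Finite W] : Type _ := RingQuot (Rel W c)

namespace CherednikAlgebra

variable [FiniteDimensional ℂ V] [Finite W]

instance : Ring (CherednikAlgebra W c) := inferInstanceAs (Ring (RingQuot (Rel W c)))

instance : Algebra ℂ (CherednikAlgebra W c) := inferInstanceAs (Algebra ℂ (RingQuot (Rel W c)))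

/-- The quotient map from the free algebra. -/
def mk : FreeAlgebra ℂ (Gen W) →ₐ[ℂ] CherednikAlgebra W c := RingQuot.mkAlgHom ℂ (Rel W c)

/-- The image in `H_c(W)` of `f ∈ V^*`. -/
def x (f : Module.Dual ℂ V) : CherednikAlgebra W c := mk W c (fx W f)

/-- The image in `H_c(W)` of `v ∈ V`. -/
def y (v : V) : CherednikAlgebra W c := mk W c (fy W v)

/-- The canonical map from `W` to `H_c(W)`. -/
def g : W →* CherednikAlgebra W c where
  toFun w := mk W c (fg W w)
  map_one' := (RingQuot.mkAlgHom_rel ℂ (Rel.g_one (W := W) (c := c))).trans (map_one (mk W c))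
  map_mul' w w' := (RingQuot.mkAlgHom_rel ℂ (Rel.g_mul (c := c) w w')).trans (map_mul (mk W c) _ _)

/-- The canonical algebra homomorphism from the group algebra `ℂ[W]` to `H_c(W)`. -/
def groupAlg : MonoidAlgebra ℂ W →ₐ[ℂ] CherednikAlgebra W c :=
  MonoidAlgebra.lift ℂ (CherednikAlgebra W c) W (g W c)

end CherednikAlgebra

end General

/-! ### The imprimitive groups `G(r,1,n)` and `G(r,p,n)` -/

/-- `ℂⁿ` with its standard Hermitian inner product. -/
abbrev Cn (n : ℕ) : Type := EuclideanSpace ℂ (Fin n)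

/-- The standard basis vector `e_j`. -/
abbrev stdVec {n : ℕ} (j : Fin n) : Cn n := EuclideanSpace.single j 1

/-- `G(r,1,n)`: the monomial transformations `e_j ↦ a_j e_{σ j}` with `a_j ^ r = 1`. -/
def Gr1 (r n : ℕ) : Subgroup (Cn n ≃ₗᵢ[ℂ] Cn n) where
  carrier := {w | ∃ (σ : Equiv.Perm (Fin n)) (a : Fin n → ℂ), (∀ j, a j ^ r = 1) ∧
    ∀ j, w (stdVec j) = a j • stdVec (σ j)}
  one_mem' := ⟨1, 1, by simp, fun j => by simp⟩
  mul_mem' := by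
    rintro u v ⟨σ, a, ha, hu⟩ ⟨ρ, b, hb, hv⟩
    refine ⟨σ * ρ, fun j => b j * a (ρ j), fun j => by simp [mul_pow, ha, hb], fun j => ?_⟩
    rw [LinearIsometryEquiv.coe_mul, Function.comp_apply, hv, map_smul, hu, smul_smul]
    rfl
  inv_mem' := by
    rintro u ⟨σ, a, ha, hu⟩
    refine ⟨σ⁻¹, fun j => (a (σ⁻¹ j))⁻¹, fun j => by simp [inv_pow, ha], fun j => ?_⟩
    have h0 : a (σ⁻¹ j) ≠ 0 := by
      intro h
      have h1 := hu (σ⁻¹ j)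
      rw [h, zero_smul, LinearIsometryEquiv.map_eq_zero_iff] at h1
      simpa using congrArg (fun v : Cn n => v (σ⁻¹ j)) h1
    rw [LinearIsometryEquiv.inv_def, LinearIsometryEquiv.symm_apply_eq, map_smul, hu, smul_smul,
      inv_mul_cancel₀ h0, one_smul]
    simp

instance Gr1.finite (r n : ℕ) [NeZero r] : Finite (Gr1 r n) := by
  choose σ a ha hw using fun w : Gr1 r n => w.2
  have hfin : {z : ℂ | z ^ r = 1}.Finite := by
    refine (Polynomial.nthRootsFinset r (1 : ℂ)).finite_toSet.subset fun z hz => ?_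
    exact (Polynomial.mem_nthRootsFinset (NeZero.pos r) 1).2 hz
  have : Finite {z : ℂ // z ^ r = 1} := hfin
  refine Finite.of_injective
    (fun w : Gr1 r n => ((σ w, fun j => ⟨a w j, ha w j⟩) :
      Equiv.Perm (Fin n) × (Fin n → {z : ℂ // z ^ r = 1}))) fun u v huv => ?_
  have h1 : σ u = σ v := congrArg Prod.fst huv
  have h2 : ∀ j, a u j = a v j := fun j =>
    congrArg Subtype.val (congrFun (congrArg Prod.snd huv) j)
  apply Subtype.ext
  apply LinearIsometryEquiv.toLinearEquiv_injective
  apply LinearEquiv.toLinearMap_injective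
  refine (EuclideanSpace.basisFun (Fin n) ℂ).toBasis.ext fun j => ?_
  simpa [h1, h2] using (hw u j).trans (by rw [h1, h2 j, ← hw v j])

/-- The primitive root of unity `e^{2πi/r}`, as a unitary scalar. -/
def zeta (r : ℕ) : unitary ℂ :=
  ⟨exp (2 * Real.pi * I / r), by
    have h : (starRingEnd ℂ) (2 * Real.pi * I / r) = -(2 * Real.pi * I / r) := by
      have h2 : (starRingEnd ℂ) 2 = 2 := map_ofNat _ 2
      simp [h2]
      ring
    constructor
    · rw [Complex.star_def, ← exp_conj, h, ← exp_add]; simp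
    · rw [Complex.star_def, ← exp_conj, h, ← exp_add]; simp⟩

/-- The diagonal transformation `diag(e^{2πi/r}, 1, …, 1)` of `ℂⁿ`. -/
def diagGen (r n : ℕ) : Cn n ≃ₗᵢ[ℂ] Cn n :=
  LinearIsometryEquiv.piLpCongrRight 2 fun j : Fin n =>
    if j.val = 0 then zeta r • LinearIsometryEquiv.refl ℂ ℂ else LinearIsometryEquiv.refl ℂ ℂ

/-- The permutation transformation `e_j ↦ e_{σ j}` of `ℂⁿ`. -/
def permGen {n : ℕ} (σ : Equiv.Perm (Fin n)) : Cn n ≃ₗᵢ[ℂ] Cn n :=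
  LinearIsometryEquiv.piLpCongrLeft 2 ℂ ℂ σ

theorem diagGen_mem (r n : ℕ) [NeZero r] : diagGen r n ∈ Gr1 r n := by
  refine ⟨1, fun j => if j.val = 0 then (zeta r : ℂ) else 1, fun j => ?_, fun j => ?_⟩
  · dsimp only
    split_ifs
    · exact (Complex.isPrimitiveRoot_exp r (NeZero.ne r)).pow_eq_one
    · exact one_pow r
  · ext i
    by_cases h : j.val = 0 <;> by_cases hij : i = j <;>
      simp [diagGen, stdVec, h, hij]

theorem permGen_mem (r : ℕ) {n : ℕ} (σ : Equiv.Perm (Fin n)) : permGen σ ∈ Gr1 r n := by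
  refine ⟨σ, fun _ => 1, fun _ => one_pow r, fun j => ?_⟩
  rw [one_smul]
  exact EuclideanSpace.piLpCongrLeft_single σ j 1

/-- The standard generators of `G(r,1,n)`, indexed from `0`: `S 0` is the generator `S_1`, namely
`diag(e^{2πi/r}, 1, …, 1)`, and `S k` for `k ≥ 1` is the generator `S_{k+1}`, which exchanges the
two adjacent basis vectors at positions `k - 1` and `k`. -/
def S (r n : ℕ) [NeZero r] (k : Fin n) : Gr1 r n :=
  if k.val = 0 then ⟨diagGen r n, diagGen_mem r n⟩
  else ⟨permGen (Equiv.swap ⟨k.val - 1, by omega⟩ k), permGen_mem r _⟩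

/-- `G(r,p,n)`: the subgroup of `G(r,1,n)` generated by `S_1^p`, `S_1⁻¹ S_2 S_1` (if `n ≥ 2`) and
`S_2, …, S_n`, regarded as a group of unitary transformations. -/
def Grp (r p n : ℕ) [NeZero r] [NeZero n] : Subgroup (Cn n ≃ₗᵢ[ℂ] Cn n) :=
  (Subgroup.closure ({S r n 0 ^ p} ∪
    {w | ∃ k : Fin n, k.val = 1 ∧ w = (S r n 0)⁻¹ * S r n k * S r n 0} ∪
    {w | ∃ k : Fin n, k ≠ 0 ∧ w = S r n k})).map (Gr1 r n).subtype

theorem Grp_le (r p n : ℕ) [NeZero r] [NeZero n] : Grp r p n ≤ Gr1 r n :=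
  Subgroup.map_subtype_le _

instance Grp.finite (r p n : ℕ) [NeZero r] [NeZero n] : Finite (Grp r p n) :=
  Finite.of_injective _ (Subgroup.inclusion_injective (Grp_le r p n))

end RationalCherednik

end

noncomputable section

namespace RationalCherednik

/-! ### Reflections, root projections and the commutator sum. -/

section Reflections

variable {V : Type*} [NormedAddCommGroup V] [InnerProductSpace ℂ V]

/-! Write W = G(r,1,n) and W' = G(r,p,n). A power of the product of the nonzero entries of a
monomial matrix is a linear character χ of W with χ(S_1) = ξ and χ(S_k) = 1 for k ≥ 2. Since every
element of W is an element of W' times a power of S_1, the kernel of χ is exactly W'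
(`exists_character`); in particular W' is normal. Twisting, w ↦ χ(w)w, gives the automorphism of
ℂ[W]. Extended by the identity on V and V^*, it respects the relations of H_c(W): in [y,x] only
reflections with c ≠ 0 contribute, and these lie in ker χ (`exists_twist`).

For the same reason the commutator formulas for W and W' agree, which gives φ : H_c(W') → H_c(W).
Injectivity needs no basis theorem. Conjugation by W acts on H_c(W') by automorphisms θ_u, so the
regular representation of H_c(W') can be induced to W. The induced space is a faithful
representation Λ of H_c(W'), and with the action of W on it Λ extends to H_c(W). Hence Λ factors
through φ, and φ is injective (`exists_injective_algHom`).

For the image, H_c(W) is spanned by products a w with a in the image of φ and w in W. Such a product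
is an eigenvector of τ with eigenvalue χ(w), so averaging over ⟨τ⟩ kills it unless w is in W'
(`mem_iff_apply_eq`).

That τ has order exactly p follows from τ(S_1) = ξ S_1 once S_1 ≠ 0 in H_c(W). As S_1 is a unit, it
is enough that H_c(W) ≠ 0, and this holds because it acts on polynomials by Dunkl operators
(`CherednikAlgebra.nontrivial`). -/

theorem mem_fixedSpace {w : V ≃ₗᵢ[ℂ] V} {v : V} : v ∈ fixedSpace w ↔ w v = v := Iff.rfl

theorem fixedSpace_conj (u w : V ≃ₗᵢ[ℂ] V) :
    fixedSpace (u * w * u⁻¹) = (fixedSpace w).map (u.toLinearEquiv : V →ₗ[ℂ] V) := by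
  ext v
  rw [mem_fixedSpace, Submodule.mem_map_equiv, mem_fixedSpace]
  change u (w (u.symm v)) = v ↔ w (u.symm v) = u.symm v
  rw [LinearIsometryEquiv.eq_symm_apply]

theorem isReflection_conj {u w : V ≃ₗᵢ[ℂ] V} (hw : IsReflection w) :
    IsReflection (u * w * u⁻¹) := by
  unfold IsReflection at *
  rw [fixedSpace_conj, LinearEquiv.finrank_map_eq, hw]

theorem isReflection_conj_iff {u w : V ≃ₗᵢ[ℂ] V} :
    IsReflection (u * w * u⁻¹) ↔ IsReflection w := by
  refine ⟨fun h => ?_, isReflection_conj⟩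
  simpa [mul_assoc] using isReflection_conj (u := u⁻¹) h

theorem IsReflection.ne_one {w : V ≃ₗᵢ[ℂ] V} (hw : IsReflection w) : w ≠ 1 := by
  rintro rfl
  have h : fixedSpace (1 : V ≃ₗᵢ[ℂ] V) = ⊤ := Submodule.eq_top_iff'.2 fun _ => rfl
  unfold IsReflection at hw
  rw [h, finrank_top] at hw
  omega

theorem IsReflection.fixedSpace_ne_top {w : V ≃ₗᵢ[ℂ] V} (hw : IsReflection w) :
    fixedSpace w ≠ ⊤ := by
  intro h
  unfold IsReflection at hw
  rw [h, finrank_top] at hw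
  omega

open Classical in
/-- The parameter function extended by zero outside the reflections. -/
def reflWeight {W : Subgroup (V ≃ₗᵢ[ℂ] V)} (c : W → ℂ) (w : W) : ℂ :=
  if IsReflection (w : V ≃ₗᵢ[ℂ] V) then c w else 0

variable [FiniteDimensional ℂ V]

/-- If `w` fixes the hyperplane of a reflection `s` pointwise and `w ≠ 1`, then `w` is a reflection
with the same hyperplane. -/
theorem IsReflection.fixedSpace_eq {s w : V ≃ₗᵢ[ℂ] V} (hs : IsReflection s)
    (h : fixedSpace s ≤ fixedSpace w) (hw : w ≠ 1) : fixedSpace w = fixedSpace s := by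
  symm
  refine Submodule.eq_of_le_of_finrank_le h ?_
  have h1 : fixedSpace w < ⊤ := by
    refine lt_top_iff_ne_top.2 fun ht => hw ?_
    ext v
    exact (ht ▸ Submodule.mem_top : v ∈ fixedSpace w)
  have h2 := Submodule.finrank_lt h1.ne
  unfold IsReflection at hs
  omega

/-- The orthogonal projection onto the orthogonal complement of the fixed space. -/
def rootProj (w : V ≃ₗᵢ[ℂ] V) : V →ₗ[ℂ] V :=
  ((fixedSpace w)ᗮ.starProjection : V →L[ℂ] V)

theorem rootProj_conj (u w : V ≃ₗᵢ[ℂ] V) (v : V) :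
    rootProj (u * w * u⁻¹) (u v) = u (rootProj w v) := by
  have h : (fixedSpace (u * w * u⁻¹))ᗮ = ((fixedSpace w)ᗮ).map (u.toLinearEquiv : V →ₗ[ℂ] V) := by
    rw [fixedSpace_conj]
    exact (Submodule.map_orthogonal_equiv _ u).symm
  have h2 := Submodule.starProjection_map_apply u (fixedSpace w)ᗮ (u v)
  simp only [LinearIsometryEquiv.symm_apply_apply] at h2
  unfold rootProj
  simp only [ContinuousLinearMap.coe_coe]
  rw [← h2]
  congr 2

theorem IsReflection.orthogonal_eq {w : V ≃ₗᵢ[ℂ] V} (hw : IsReflection w) {v : V}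
    (hv : v ∈ (fixedSpace w)ᗮ) (h0 : v ≠ 0) : (fixedSpace w)ᗮ = ℂ ∙ v := by
  symm
  refine Submodule.eq_of_le_of_finrank_le (by simpa using hv) ?_
  rw [finrank_span_singleton h0]
  have := (fixedSpace w).finrank_add_finrank_orthogonal
  unfold IsReflection at hw
  omega

theorem IsReflection.rootProj_apply {w : V ≃ₗᵢ[ℂ] V} (hw : IsReflection w) {v : V}
    (hv : v ∈ (fixedSpace w)ᗮ) (h0 : v ≠ 0) (y : V) :
    rootProj w y = (inner ℂ v y / inner ℂ v v) • v := by
  unfold rootProj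
  simp only [ContinuousLinearMap.coe_coe]
  have h : ∀ K : Submodule ℂ V, K = ℂ ∙ v →
      K.starProjection y = (inner ℂ v y / inner ℂ v v) • v := by
    rintro K rfl
    have h := Submodule.starProjection_singleton ℂ (v := v) y
    rw [inner_self_eq_norm_sq_to_K]
    push_cast at h
    exact h
  exact h _ (hw.orthogonal_eq hv h0)

/-- Trades the chosen normal vector for the orthogonal projection to the root line, which involves
no choice and is therefore equivariant under conjugation (`rootProj_conj`). -/
theorem IsReflection.hyperplaneCoeff_eq {w : V ≃ₗᵢ[ℂ] V} (hw : IsReflection w) (y : V)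
    (f : Module.Dual ℂ V) : hyperplaneCoeff (fixedSpace w) y f = f (rootProj w y) := by
  obtain ⟨h1, h2⟩ := normal_spec hw.fixedSpace_ne_top
  rw [hw.rootProj_apply h1 h2, map_smul, hyperplaneCoeff, smul_eq_mul]
  ring

theorem sub_rootProj_mem (w : V ≃ₗᵢ[ℂ] V) (y : V) : y - rootProj w y ∈ fixedSpace w := by
  have h := (fixedSpace w)ᗮ.sub_starProjection_mem_orthogonal y
  rwa [Submodule.orthogonal_orthogonal] at h

/-- A reflection moves vectors by a fixed multiple of their projection to the root line. -/
theorem IsReflection.exists_sub_apply {w : V ≃ₗᵢ[ℂ] V} (hw : IsReflection w) :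
    ∃ k : ℂ, k ≠ 0 ∧ ∀ y, y - w y = k • rootProj w y := by
  obtain ⟨h1, h2⟩ := normal_spec hw.fixedSpace_ne_top
  set v := normal (fixedSpace w) with hv
  -- Being unitary, w preserves the orthogonal complement of its fixed space, here a line; so v is
  -- an eigenvector.
  have hwv : v - w v ∈ (fixedSpace w)ᗮ := by
    refine Submodule.sub_mem _ h1 ?_
    rw [Submodule.mem_orthogonal] at h1 ⊢
    intro u hu
    rw [← mem_fixedSpace.1 hu, LinearIsometryEquiv.inner_map_map]
    exact h1 u hu
  rw [hw.orthogonal_eq h1 h2, Submodule.mem_span_singleton] at hwv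
  obtain ⟨k, hk⟩ := hwv
  have key : ∀ y, y - w y = k • rootProj w y := by
    intro y
    have h3 := mem_fixedSpace.1 (sub_rootProj_mem w y)
    rw [map_sub] at h3
    -- The part of y in the fixed space cancels in y - w y.
    have h4 : y - w y = rootProj w y - w (rootProj w y) := by
      rw [sub_eq_sub_iff_add_eq_add] at h3 ⊢
      rw [← sub_eq_zero] at h3 ⊢
      rw [← neg_eq_zero, ← h3]
      abel
    rw [h4, hw.rootProj_apply h1 h2, map_smul, ← smul_sub, ← hk, smul_comm]
  refine ⟨k, ?_, key⟩
  rintro rfl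
  refine hw.ne_one ?_
  ext y
  have := key y
  rw [zero_smul, sub_eq_zero] at this
  exact this.symm

/-- All projections lie on one line. This symmetry in y and z is what makes Dunkl operators commute.
-/
theorem IsReflection.rootProj_proportional {w : V ≃ₗᵢ[ℂ] V} (hw : IsReflection w)
    (f : Module.Dual ℂ V) (y z : V) :
    f (rootProj w y) • rootProj w z = f (rootProj w z) • rootProj w y := by
  obtain ⟨h1, h2⟩ := normal_spec hw.fixedSpace_ne_top
  simp only [hw.rootProj_apply h1 h2, map_smul, smul_smul, smul_eq_mul]
  congr 1
  ring

/-- The sum over hyperplanes and their pointwise stabilizers is a sum over reflections. -/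
theorem map_sum_gammaElt {W : Subgroup (V ≃ₗᵢ[ℂ] V)} [Fintype W] (c : W → ℂ) {B : Type*} [Ring B]
    [Algebra ℂ B] (F : FreeAlgebra ℂ (Gen W) →ₐ[ℂ] B) (v : V) (f : Module.Dual ℂ V) :
    F (∑ᶠ H ∈ arrangement W, hyperplaneCoeff H v f • gammaElt W c H) =
      ∑ w : W, (reflWeight c w * f (rootProj (w : V ≃ₗᵢ[ℂ] V) v)) • F (fg W w) := by
  classical
  have hfin := arrangement_finite W
  rw [finsum_mem_eq_finite_toFinset_sum _ hfin, map_sum]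
  have h1 : ∀ w : W, (reflWeight c w * f (rootProj (w : V ≃ₗᵢ[ℂ] V) v)) • F (fg W w) =
      if IsReflection (w : V ≃ₗᵢ[ℂ] V) then
        (c w * f (rootProj (w : V ≃ₗᵢ[ℂ] V) v)) • F (fg W w) else 0 := by
    intro w
    unfold reflWeight
    split_ifs <;> simp
  -- Group the reflections according to their hyperplane.
  rw [Finset.sum_congr rfl fun w _ => h1 w, ← Finset.sum_filter,
    ← Finset.sum_fiberwise_of_maps_to (t := hfin.toFinset)
      (g := fun w : W => fixedSpace (w : V ≃ₗᵢ[ℂ] V))]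
  swap
  · intro w hw
    rw [Set.Finite.mem_toFinset]
    exact ⟨w, w.2, (Finset.mem_filter.1 hw).2, rfl⟩
  refine Finset.sum_congr rfl fun H hH => ?_
  obtain ⟨s, hsW, hs, rfl⟩ := hfin.mem_toFinset.1 hH
  -- A nontrivial element fixing a hyperplane pointwise is a reflection with exactly that
  -- hyperplane, so each fibre is W_H without 1.
  have hset : {w : W | w ∈ pointStabilizer W (fixedSpace s) ∧ w ≠ 1} =
      ((Finset.univ.filter fun w : W => IsReflection (w : V ≃ₗᵢ[ℂ] V)).filter
        fun w => fixedSpace (w : V ≃ₗᵢ[ℂ] V) = fixedSpace s : Finset W) := by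
    ext w
    simp only [Set.mem_ofPred_eq, Finset.coe_filter, Finset.mem_filter, Finset.mem_univ, true_and]
    constructor
    · rintro ⟨h1, h2⟩
      have h3 : fixedSpace (w : V ≃ₗᵢ[ℂ] V) = fixedSpace s :=
        hs.fixedSpace_eq (fun v hv => h1 v hv) fun h => h2 (Subtype.ext h)
      refine ⟨?_, h3⟩
      unfold IsReflection at *
      rwa [h3]
    · rintro ⟨h1, h2⟩
      refine ⟨fun v hv => ?_, fun h => h1.ne_one (by rw [h]; rfl)⟩
      rw [← h2] at hv
      exact hv
  rw [gammaElt, hset, finsum_mem_coe_finset, Finset.smul_sum, map_sum]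
  refine Finset.sum_congr rfl fun w hw => ?_
  rw [Finset.mem_filter, Finset.mem_filter] at hw
  rw [← hw.2, hw.1.2.hyperplaneCoeff_eq, map_smul, map_smul, smul_smul, mul_comm]

end Reflections

/-! ### Relations and universal property of the Cherednik algebra. -/

namespace CherednikAlgebra

variable {V : Type*} [NormedAddCommGroup V] [InnerProductSpace ℂ V] [FiniteDimensional ℂ V]
variable {W : Subgroup (V ≃ₗᵢ[ℂ] V)} (c : W → ℂ)

/-- The action of `w` on linear forms. -/
abbrev dualAct (w : W) (f : Module.Dual ℂ V) : Module.Dual ℂ V :=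
  f ∘ₗ ((w⁻¹ : W) : V ≃ₗᵢ[ℂ] V).toLinearEquiv.toLinearMap

section Relations

variable [Finite W]

theorem mk_eq_of_rel {a b : FreeAlgebra ℂ (Gen W)} (h : Rel W c a b) : mk W c a = mk W c b :=
  RingQuot.mkAlgHom_rel ℂ h

theorem x_add (f f' : Module.Dual ℂ V) : x W c (f + f') = x W c f + x W c f' :=
  (mk_eq_of_rel c (Rel.x_add f f')).trans (map_add _ _ _)

theorem x_smul (a : ℂ) (f : Module.Dual ℂ V) : x W c (a • f) = a • x W c f :=
  (mk_eq_of_rel c (Rel.x_smul a f)).trans (map_smul _ _ _)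

theorem y_add (v v' : V) : y W c (v + v') = y W c v + y W c v' :=
  (mk_eq_of_rel c (Rel.y_add v v')).trans (map_add _ _ _)

theorem y_smul (a : ℂ) (v : V) : y W c (a • v) = a • y W c v :=
  (mk_eq_of_rel c (Rel.y_smul a v)).trans (map_smul _ _ _)

theorem x_comm (f f' : Module.Dual ℂ V) : x W c f * x W c f' = x W c f' * x W c f := by
  have h := mk_eq_of_rel c (Rel.x_comm f f')
  rw [map_mul, map_mul] at h
  exact h

theorem y_comm (v v' : V) : y W c v * y W c v' = y W c v' * y W c v := by
  have h := mk_eq_of_rel c (Rel.y_comm v v')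
  rw [map_mul, map_mul] at h
  exact h

theorem g_mul_x_mul_g_inv (w : W) (f : Module.Dual ℂ V) :
    g W c w * x W c f * g W c w⁻¹ = x W c (dualAct w f) := by
  have h := mk_eq_of_rel c (Rel.g_x w f)
  rw [map_mul, map_mul] at h
  exact h

theorem g_mul_y_mul_g_inv (w : W) (v : V) :
    g W c w * y W c v * g W c w⁻¹ = y W c ((w : V ≃ₗᵢ[ℂ] V) v) := by
  have h := mk_eq_of_rel c (Rel.g_y w v)
  rw [map_mul, map_mul] at h
  exact h

end Relations

theorem y_mul_x_sub [Fintype W] (v : V) (f : Module.Dual ℂ V) :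
    y W c v * x W c f - x W c f * y W c v =
      algebraMap ℂ _ (f v) +
        ∑ w : W, (reflWeight c w * f (rootProj (w : V ≃ₗᵢ[ℂ] V) v)) • g W c w := by
  have h := mk_eq_of_rel c (Rel.y_x (c := c) v f)
  rw [map_add, map_sum_gammaElt, map_sub, map_mul, map_mul, AlgHom.commutes] at h
  exact h

/-- Two algebra homomorphisms which agree on the generators are equal. -/
theorem algHom_ext [Finite W] {B : Type*} [Ring B] [Algebra ℂ B]
    {φ ψ : CherednikAlgebra W c →ₐ[ℂ] B}
    (hx : ∀ f, φ (x W c f) = ψ (x W c f)) (hy : ∀ v, φ (y W c v) = ψ (y W c v))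
    (hg : ∀ w, φ (g W c w) = ψ (g W c w)) : φ = ψ := by
  refine RingQuot.ringQuot_ext' ℂ (s := Rel W c) φ ψ ?_
  refine FreeAlgebra.hom_ext ?_
  funext a
  cases a with
  | x f => exact hx f
  | y v => exact hy v
  | g w => exact hg w

/-- The universal property of the rational Cherednik algebra, with the commutation relation
written as a sum over reflections. -/
theorem exists_lift [Fintype W] {B : Type*} [Ring B] [Algebra ℂ B] (X : Module.Dual ℂ V →ₗ[ℂ] B)
    (Y : V →ₗ[ℂ] B) (G : W →* B) (hX : ∀ f f', X f * X f' = X f' * X f)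
    (hY : ∀ v v', Y v * Y v' = Y v' * Y v)
    (hGX : ∀ w f, G w * X f * G w⁻¹ = X (dualAct w f))
    (hGY : ∀ (w : W) v, G w * Y v * G w⁻¹ = Y ((w : V ≃ₗᵢ[ℂ] V) v))
    (hYX : ∀ v f, Y v * X f - X f * Y v = algebraMap ℂ B (f v) +
      ∑ w : W, (reflWeight c w * f (rootProj (w : V ≃ₗᵢ[ℂ] V) v)) • G w) :
    ∃ φ : CherednikAlgebra W c →ₐ[ℂ] B, (∀ f, φ (x W c f) = X f) ∧ (∀ v, φ (y W c v) = Y v) ∧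
      ∀ w, φ (g W c w) = G w := by
  let F : FreeAlgebra ℂ (Gen W) →ₐ[ℂ] B := FreeAlgebra.lift ℂ fun a => match a with
    | Gen.x f => X f
    | Gen.y v => Y v
    | Gen.g w => G w
  have Fx : ∀ f, F (fx W f) = X f := fun f => FreeAlgebra.lift_ι_apply _ _
  have Fy : ∀ v, F (fy W v) = Y v := fun v => FreeAlgebra.lift_ι_apply _ _
  have Fg : ∀ w, F (fg W w) = G w := fun w => FreeAlgebra.lift_ι_apply _ _
  have hF : ∀ ⦃a b⦄, Rel W c a b → F a = F b := by
    intro a b h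
    cases h with
    | x_add f f' => simp only [map_add, Fx]
    | x_smul a f => simp only [map_smul, Fx]
    | y_add v v' => simp only [map_add, Fy]
    | y_smul a v => simp only [map_smul, Fy]
    | g_one => simp only [map_one, Fg]
    | g_mul w w' => simp only [map_mul, Fg]
    | x_comm f f' => simp only [map_mul, Fx, hX f f']
    | y_comm v v' => simp only [map_mul, Fy, hY v v']
    | g_x w f => simp only [map_mul, Fx, Fg, hGX]
    | g_y w v => simp only [map_mul, Fy, Fg, hGY]
    | y_x v f =>
      rw [map_add, map_sum_gammaElt, map_sub, map_mul, map_mul, AlgHom.commutes, Fx, Fy, hYX]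
      simp only [Fg]
  refine ⟨RingQuot.liftAlgHom ℂ ⟨F, hF⟩, fun f => ?_, fun v => ?_, fun w => ?_⟩
  · exact (RingQuot.liftAlgHom_mkAlgHom_apply ℂ F hF _).trans (Fx f)
  · exact (RingQuot.liftAlgHom_mkAlgHom_apply ℂ F hF _).trans (Fy v)
  · exact (RingQuot.liftAlgHom_mkAlgHom_apply ℂ F hF _).trans (Fg w)

/-- The linear map `V^* → H_c(W)`. -/
def xLin [Finite W] : Module.Dual ℂ V →ₗ[ℂ] CherednikAlgebra W c where
  toFun := x W c
  map_add' := x_add c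
  map_smul' := x_smul c

/-- The linear map `V → H_c(W)`. -/
def yLin [Finite W] : V →ₗ[ℂ] CherednikAlgebra W c where
  toFun := y W c
  map_add' := y_add c
  map_smul' := y_smul c

/-! ### Normal subgroups: conjugation action, induced representation, embedding. -/

section Subgroup

universe u

variable {V : Type u} [NormedAddCommGroup V] [InnerProductSpace ℂ V]
variable {W W' : Subgroup (V ≃ₗᵢ[ℂ] V)}

/-- Conjugation by an element of `W` on a subgroup normalized by `W`. -/
def conjEquiv (hn : ∀ u ∈ W, ∀ v ∈ W', u * v * u⁻¹ ∈ W') (u : W) : W' ≃* W' where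
  toFun v := ⟨u * v * (u : V ≃ₗᵢ[ℂ] V)⁻¹, hn _ u.2 _ v.2⟩
  invFun v := ⟨(u : V ≃ₗᵢ[ℂ] V)⁻¹ * v * u, by simpa using hn _ (inv_mem u.2) _ v.2⟩
  left_inv v := Subtype.ext (by simp [mul_assoc])
  right_inv v := Subtype.ext (by simp [mul_assoc])
  map_mul' v v' := Subtype.ext (by simp [mul_assoc])

variable (hn : ∀ u ∈ W, ∀ v ∈ W', u * v * u⁻¹ ∈ W')

@[simp]
theorem coe_conjEquiv (u : W) (v : W') :
    (conjEquiv hn u v : V ≃ₗᵢ[ℂ] V) = u * v * (u : V ≃ₗᵢ[ℂ] V)⁻¹ := rfl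

variable (hle : W' ≤ W) (c : W → ℂ)

/-- The restriction of a parameter function to a subgroup. -/
abbrev resParam (w : W') : ℂ := c (Subgroup.inclusion hle w)

theorem dualAct_mul (u v : W) (f : Module.Dual ℂ V) :
    dualAct (u * v) f = dualAct u (dualAct v f) := by
  ext z
  simp [dualAct, mul_inv_rev]

theorem dualAct_one (f : Module.Dual ℂ V) : dualAct (1 : W) f = f := by
  ext z
  simp [dualAct]

@[simp]
theorem dualAct_apply_apply (u : W) (f : Module.Dual ℂ V) (v : V) :
    dualAct u f ((u : V ≃ₗᵢ[ℂ] V) v) = f v := by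
  change f ((u : V ≃ₗᵢ[ℂ] V).symm ((u : V ≃ₗᵢ[ℂ] V) v)) = f v
  rw [LinearIsometryEquiv.symm_apply_apply]

/-- The action of linear transformations on linear forms, as a linear map. -/
def dualActLin (u : W) : Module.Dual ℂ V →ₗ[ℂ] Module.Dual ℂ V :=
  LinearMap.lcomp ℂ ℂ ((u⁻¹ : W) : V ≃ₗᵢ[ℂ] V).toLinearEquiv.toLinearMap

theorem reflWeight_conj
    (hc : ∀ w s : W, IsReflection (s : V ≃ₗᵢ[ℂ] V) → c (w * s * w⁻¹) = c s) (u : W) (v : W') :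
    reflWeight (resParam hle c) (conjEquiv hn u v) = reflWeight (resParam hle c) v := by
  unfold reflWeight
  rw [coe_conjEquiv, isReflection_conj_iff]
  split_ifs with h
  · exact hc u (Subgroup.inclusion hle v) h
  · rfl

variable [FiniteDimensional ℂ V] [Fintype W']

/-- The defining relations are equivariant under W: conjugation permutes the reflections of W',
carries root projections to root projections, and preserves c. -/
theorem exists_conj_algHom
    (hc : ∀ w s : W, IsReflection (s : V ≃ₗᵢ[ℂ] V) → c (w * s * w⁻¹) = c s) (u : W) :
    ∃ θ : CherednikAlgebra W' (resParam hle c) →ₐ[ℂ] CherednikAlgebra W' (resParam hle c),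
      (∀ f, θ (x W' _ f) = x W' _ (dualAct u f)) ∧
      (∀ v, θ (y W' _ v) = y W' _ ((u : V ≃ₗᵢ[ℂ] V) v)) ∧
      ∀ w, θ (g W' _ w) = g W' _ (conjEquiv hn u w) := by
  set c' : W' → ℂ := resParam hle c with hc'
  refine exists_lift c' (xLin c' ∘ₗ dualActLin u)
    (yLin c' ∘ₗ (u : V ≃ₗᵢ[ℂ] V).toLinearEquiv.toLinearMap)
    ((g W' c').comp (conjEquiv hn u).toMonoidHom) (fun f f' => x_comm c' _ _)
    (fun v v' => y_comm c' _ _) (fun w f => ?_) (fun w v => ?_) (fun v f => ?_)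
  · change g W' c' (conjEquiv hn u w) * x W' c' (dualAct u f) * g W' c' (conjEquiv hn u w⁻¹) =
      x W' c' (dualAct u (dualAct w f))
    rw [map_inv, g_mul_x_mul_g_inv]
    congr 1
    ext z
    simp [dualAct, mul_assoc]
  · change g W' c' (conjEquiv hn u w) * y W' c' ((u : V ≃ₗᵢ[ℂ] V) v) *
      g W' c' (conjEquiv hn u w⁻¹) = y W' c' ((u : V ≃ₗᵢ[ℂ] V) ((w : V ≃ₗᵢ[ℂ] V) v))
    rw [map_inv, g_mul_y_mul_g_inv]
    congr 1
    simp
  · change y W' c' ((u : V ≃ₗᵢ[ℂ] V) v) * x W' c' (dualAct u f) -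
      x W' c' (dualAct u f) * y W' c' ((u : V ≃ₗᵢ[ℂ] V) v) = algebraMap ℂ _ (f v) +
        ∑ w : W', (reflWeight c' w * f (rootProj (w : V ≃ₗᵢ[ℂ] V) v)) •
          g W' c' (conjEquiv hn u w)
    rw [y_mul_x_sub, dualAct_apply_apply, ← (conjEquiv hn u).toEquiv.sum_comp]
    congr 1
    refine Finset.sum_congr rfl fun w _ => ?_
    change (reflWeight c' (conjEquiv hn u w) * dualAct u f (rootProj (conjEquiv hn u w :
      V ≃ₗᵢ[ℂ] V) ((u : V ≃ₗᵢ[ℂ] V) v))) • g W' c' (conjEquiv hn u w) = _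
    rw [reflWeight_conj hn hle c hc, coe_conjEquiv, rootProj_conj, dualAct_apply_apply]

/-- Conjugation by `W` extends to the Cherednik algebra of a normal subgroup. -/
theorem exists_conj_action
    (hc : ∀ w s : W, IsReflection (s : V ≃ₗᵢ[ℂ] V) → c (w * s * w⁻¹) = c s) :
    ∃ θ : W → CherednikAlgebra W' (resParam hle c) →ₐ[ℂ] CherednikAlgebra W' (resParam hle c),
      (∀ u f, θ u (x W' _ f) = x W' _ (dualAct u f)) ∧
      (∀ u v, θ u (y W' _ v) = y W' _ ((u : V ≃ₗᵢ[ℂ] V) v)) ∧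
      (∀ u w, θ u (g W' _ w) = g W' _ (conjEquiv hn u w)) ∧
      (∀ u v, θ (u * v) = (θ u).comp (θ v)) ∧ θ 1 = AlgHom.id ℂ _ ∧
      ∀ (v : W') a, θ (Subgroup.inclusion hle v) a * g W' _ v = g W' _ v * a := by
  choose θ hθx hθy hθg using exists_conj_algHom hn hle c hc
  have hθ : ∀ u v, θ (u * v) = (θ u).comp (θ v) := by
    refine fun u v => algHom_ext _ (fun f => ?_) (fun z => ?_) (fun w => ?_)
    · rw [AlgHom.comp_apply, hθx, hθx, hθx, dualAct_mul]
    · rw [AlgHom.comp_apply, hθy, hθy, hθy]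
      rfl
    · rw [AlgHom.comp_apply, hθg, hθg, hθg]
      exact congrArg _ (Subtype.ext (by simp [mul_assoc]))
  have hθ1 : θ 1 = AlgHom.id ℂ _ := by
    refine algHom_ext _ (fun f => ?_) (fun z => ?_) (fun w => ?_)
    · rw [hθx, dualAct_one]
      rfl
    · rw [hθy]
      rfl
    · rw [hθg, AlgHom.id_apply]
      exact congrArg _ (Subtype.ext (by simp))
  have hθin : ∀ (v : W') a, θ (Subgroup.inclusion hle v) a * g W' _ v = g W' _ v * a := by
    intro v a
    -- Inner conjugation by v; it agrees with θ at v on all generators, hence everywhere.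
    let κ : CherednikAlgebra W' (resParam hle c) →ₐ[ℂ] CherednikAlgebra W' (resParam hle c) :=
      AlgHom.ofLinearMap
        (LinearMap.mulRight ℂ (g W' (resParam hle c) v⁻¹) ∘ₗ
          LinearMap.mulLeft ℂ (g W' (resParam hle c) v))
        (by simp [← map_mul])
        (fun a b => by
          have h : g W' (resParam hle c) v⁻¹ * g W' (resParam hle c) v = 1 := by
            rw [← map_mul, inv_mul_cancel, map_one]
          simp only [LinearMap.comp_apply, LinearMap.mulLeft_apply, LinearMap.mulRight_apply]
          simp only [mul_assoc]
          rw [← mul_assoc (g W' (resParam hle c) v⁻¹) (g W' (resParam hle c) v), h, one_mul])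
    have hκ : ∀ a, κ a = g W' (resParam hle c) v * a * g W' (resParam hle c) v⁻¹ := fun _ => rfl
    have h : θ (Subgroup.inclusion hle v) = κ := by
      refine algHom_ext _ (fun f => ?_) (fun z => ?_) (fun w => ?_)
      · rw [hθx, hκ, g_mul_x_mul_g_inv]
        rfl
      · rw [hθy, hκ, g_mul_y_mul_g_inv]
        rfl
      · rw [hθg, hκ, ← map_mul, ← map_mul]
        rfl
    rw [h, hκ, mul_assoc _ _ (g W' _ v), ← map_mul, inv_mul_cancel, map_one, mul_one]
  exact ⟨θ, hθx, hθy, hθg, hθ, hθ1, hθin⟩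

/-- The representation of `H_c(W)` induced from the regular representation of the Cherednik algebra
of a normal subgroup: the functions `F` on `W` with `F (u v⁻¹) = v F(u)` for `v ∈ W'`. -/
def inducedSpace : Submodule ℂ (W → CherednikAlgebra W' (resParam hle c)) where
  carrier := {F | ∀ (u : W) (v : W'),
    F (u * (Subgroup.inclusion hle v)⁻¹) = g W' (resParam hle c) v * F u}
  zero_mem' := fun u v => by simp
  add_mem' := fun {F F'} hF hF' u v => by
    rw [Pi.add_apply, Pi.add_apply, hF u v, hF' u v, mul_add]
  smul_mem' := fun a F hF u v => by
    rw [Pi.smul_apply, Pi.smul_apply, hF u v, mul_smul_comm]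

/-- Left translation on the induced representation. -/
def inducedGroup : W →* Module.End ℂ (inducedSpace hle c) where
  toFun w :=
    { toFun := fun F => ⟨fun u => F.1 (w⁻¹ * u), fun u v => by
          simpa only [mul_assoc] using F.2 (w⁻¹ * u) v⟩
      map_add' := fun _ _ => rfl
      map_smul' := fun _ _ => rfl }
  map_one' := by
    refine LinearMap.ext fun F => Subtype.ext (funext fun u => ?_)
    change F.1 (1⁻¹ * u) = F.1 u
    simp
  map_mul' w w' := by
    refine LinearMap.ext fun F => Subtype.ext (funext fun u => ?_)
    change F.1 ((w * w')⁻¹ * u) = F.1 (w'⁻¹ * (w⁻¹ * u))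
    rw [mul_inv_rev, mul_assoc]

/-- The action of the Cherednik algebra of the normal subgroup on the induced representation, for
a family `θ` of automorphisms that extends conjugation. -/
def inducedAlg
    (θ : W → CherednikAlgebra W' (resParam hle c) →ₐ[ℂ] CherednikAlgebra W' (resParam hle c))
    (hθ : ∀ u v, θ (u * v) = (θ u).comp (θ v))
    (hθin : ∀ (v : W') a, θ (Subgroup.inclusion hle v) a * g W' _ v = g W' _ v * a) :
    CherednikAlgebra W' (resParam hle c) →ₐ[ℂ] Module.End ℂ (inducedSpace hle c) :=
  AlgHom.ofLinearMap
    { toFun := fun a =>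
        { toFun := fun F => ⟨fun u => θ u⁻¹ a * F.1 u, fun u v => by
            -- Equivariance survives because θ at v is inner: θ_v(b) v = v b with b = θ_{u⁻¹}(a).
            have h : (u * (Subgroup.inclusion hle v)⁻¹)⁻¹ = Subgroup.inclusion hle v * u⁻¹ := by
              rw [mul_inv_rev, inv_inv]
            change θ (u * (Subgroup.inclusion hle v)⁻¹)⁻¹ a *
              F.1 (u * (Subgroup.inclusion hle v)⁻¹) = _
            rw [F.2 u v, h, hθ, AlgHom.comp_apply, ← mul_assoc, hθin, mul_assoc]⟩
          map_add' := fun F F' => Subtype.ext (funext fun u => mul_add _ _ _)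
          map_smul' := fun r F => Subtype.ext (funext fun u => mul_smul_comm r (θ u⁻¹ a) (F.1 u)) }
      map_add' := fun a b => LinearMap.ext fun F => Subtype.ext (funext fun u => by
        change θ u⁻¹ (a + b) * F.1 u = θ u⁻¹ a * F.1 u + θ u⁻¹ b * F.1 u
        rw [map_add, add_mul])
      map_smul' := fun r a => LinearMap.ext fun F => Subtype.ext (funext fun u => by
        change θ u⁻¹ (r • a) * F.1 u = r • (θ u⁻¹ a * F.1 u)
        rw [map_smul, smul_mul_assoc]) }
    (LinearMap.ext fun F => Subtype.ext (funext fun u => by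
      change θ u⁻¹ 1 * F.1 u = F.1 u
      rw [map_one, one_mul]))
    (fun a b => LinearMap.ext fun F => Subtype.ext (funext fun u => by
      change θ u⁻¹ (a * b) * F.1 u = θ u⁻¹ a * (θ u⁻¹ b * F.1 u)
      rw [map_mul, mul_assoc]))

/-- The action on the induced representation is faithful. -/
theorem injective_of_apply_eq
    (θ : W → CherednikAlgebra W' (resParam hle c) →ₐ[ℂ] CherednikAlgebra W' (resParam hle c))
    (hθ1 : θ 1 = AlgHom.id ℂ _)
    (Λ : CherednikAlgebra W' (resParam hle c) →ₐ[ℂ] Module.End ℂ (inducedSpace hle c))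
    (hΛ : ∀ a F u, (Λ a F).1 u = θ u⁻¹ a * F.1 u) : Function.Injective Λ := by
  classical
  -- The function supported on W' with F(u) = u⁻¹ there. Since F(1) = 1, the value of Λ(a)F at 1 is
  -- a itself.
  let F : inducedSpace hle c := ⟨fun u => if h : ((u⁻¹ : W) : V ≃ₗᵢ[ℂ] V) ∈ W' then
    g W' (resParam hle c) ⟨_, h⟩ else 0, fun u v => by
      have h1 : (((u * (Subgroup.inclusion hle v)⁻¹)⁻¹ : W) : V ≃ₗᵢ[ℂ] V) =
          v * ((u⁻¹ : W) : V ≃ₗᵢ[ℂ] V) := by simp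
      beta_reduce
      by_cases h : ((u⁻¹ : W) : V ≃ₗᵢ[ℂ] V) ∈ W'
      · rw [dif_pos (h1 ▸ W'.mul_mem v.2 h), dif_pos h, ← map_mul]
        exact congrArg _ (Subtype.ext h1)
      · rw [dif_neg (fun h2 => h ((W'.mul_mem_cancel_left v.2).1 (h1 ▸ h2))), dif_neg h,
          mul_zero]⟩
  have hF : F.1 1 = 1 := by
    have h : ((1⁻¹ : W) : V ≃ₗᵢ[ℂ] V) ∈ W' := by simp
    change dite _ _ _ = _
    rw [dif_pos h, ← map_one (g W' (resParam hle c))]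
    exact congrArg _ (Subtype.ext (by simp))
  intro a b hab
  have h := congrArg (fun T => (T F).1 1) hab
  simp only [hΛ, hF, inv_one, hθ1, mul_one, AlgHom.id_apply] at h
  exact h

/-- At u both sides multiply F(u) by θ_{u⁻¹w}(a). -/
theorem inducedGroup_conj
    (θ : W → CherednikAlgebra W' (resParam hle c) →ₐ[ℂ] CherednikAlgebra W' (resParam hle c))
    (hθ : ∀ u v, θ (u * v) = (θ u).comp (θ v))
    (Λ : CherednikAlgebra W' (resParam hle c) →ₐ[ℂ] Module.End ℂ (inducedSpace hle c))
    (hΛ : ∀ a F u, (Λ a F).1 u = θ u⁻¹ a * F.1 u)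
    (R : W →* Module.End ℂ (inducedSpace hle c)) (hR : ∀ w F u, (R w F).1 u = F.1 (w⁻¹ * u))
    (w : W) (a : CherednikAlgebra W' (resParam hle c)) : R w * Λ a * R w⁻¹ = Λ (θ w a) := by
  refine LinearMap.ext fun F => Subtype.ext (funext fun u => ?_)
  rw [Module.End.mul_apply, Module.End.mul_apply, hR, hΛ, hR, hΛ, ← AlgHom.comp_apply, ← hθ,
    mul_inv_rev, inv_inv, mul_inv_cancel_left]

/-- Both group actions agree on W' by the equivariance of F: multiplying F(u) by u⁻¹vu gives
F(u(u⁻¹vu)⁻¹) = F(v⁻¹u). -/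
theorem inducedAlg_g
    (θ : W → CherednikAlgebra W' (resParam hle c) →ₐ[ℂ] CherednikAlgebra W' (resParam hle c))
    (hθg : ∀ u w, θ u (g W' _ w) = g W' _ (conjEquiv hn u w))
    (Λ : CherednikAlgebra W' (resParam hle c) →ₐ[ℂ] Module.End ℂ (inducedSpace hle c))
    (hΛ : ∀ a F u, (Λ a F).1 u = θ u⁻¹ a * F.1 u)
    (R : W →* Module.End ℂ (inducedSpace hle c)) (hR : ∀ w F u, (R w F).1 u = F.1 (w⁻¹ * u))
    (v : W') : Λ (g W' _ v) = R (Subgroup.inclusion hle v) := by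
  refine LinearMap.ext fun F => Subtype.ext (funext fun u => ?_)
  have h : F.1 (u * (Subgroup.inclusion hle (conjEquiv hn u⁻¹ v))⁻¹) =
    g W' _ (conjEquiv hn u⁻¹ v) * F.1 u := F.2 u (conjEquiv hn u⁻¹ v)
  refine (hΛ (g W' _ v) F u).trans (Eq.trans ?_ (hR (Subgroup.inclusion hle v) F u).symm)
  rw [hθg, ← h]
  exact congrArg F.1 (Subtype.ext (by simp [mul_assoc]))

/-- The Cherednik algebra of a normal subgroup has a faithful representation to which the action
of the group extends. -/
theorem exists_faithful_rep
    (θ : W → CherednikAlgebra W' (resParam hle c) →ₐ[ℂ] CherednikAlgebra W' (resParam hle c))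
    (hθg : ∀ u w, θ u (g W' _ w) = g W' _ (conjEquiv hn u w))
    (hθ : ∀ u v, θ (u * v) = (θ u).comp (θ v)) (hθ1 : θ 1 = AlgHom.id ℂ _)
    (hθin : ∀ (v : W') a, θ (Subgroup.inclusion hle v) a * g W' _ v = g W' _ v * a) :
    ∃ (B : Type u) (_ : Ring B) (_ : Algebra ℂ B)
      (Λ : CherednikAlgebra W' (resParam hle c) →ₐ[ℂ] B) (R : W →* B), Function.Injective Λ ∧
      (∀ v : W', Λ (g W' _ v) = R (Subgroup.inclusion hle v)) ∧
      ∀ w a, R w * Λ a * R w⁻¹ = Λ (θ w a) :=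
  ⟨Module.End ℂ (inducedSpace hle c), inferInstance, inferInstance,
    inducedAlg hle c θ hθ hθin, inducedGroup hle c,
    injective_of_apply_eq hle c θ hθ1 _ fun _ _ _ => rfl,
    inducedAlg_g hn hle c θ hθg _ (fun _ _ _ => rfl) _ fun _ _ _ => rfl,
    inducedGroup_conj hle c θ hθ _ (fun _ _ _ => rfl) _ fun _ _ _ => rfl⟩

variable [Fintype W]

/-- The sum over the reflections of `W` in the defining relation only involves the subgroup. -/
theorem sum_reflWeight_inclusion
    (hc0 : ∀ s : W, IsReflection (s : V ≃ₗᵢ[ℂ] V) → (s : V ≃ₗᵢ[ℂ] V) ∉ W' → c s = 0)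
    {B : Type*} [AddCommMonoid B] [Module ℂ B] (G : W → B) (v : V) (f : Module.Dual ℂ V) :
    ∑ w : W', (reflWeight (resParam hle c) w * f (rootProj (w : V ≃ₗᵢ[ℂ] V) v)) •
        G (Subgroup.inclusion hle w) =
      ∑ w : W, (reflWeight c w * f (rootProj (w : V ≃ₗᵢ[ℂ] V) v)) • G w := by
  refine Fintype.sum_of_injective (Subgroup.inclusion hle) (Subgroup.inclusion_injective hle) _ _
    (fun w hw => ?_) fun w => rfl
  have h : reflWeight c w = 0 := by
    unfold reflWeight
    split_ifs with h
    · refine hc0 w h fun hw' => hw ⟨⟨w, hw'⟩, rfl⟩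
    · rfl
  rw [h, zero_mul, zero_smul]

/-- A representation of the Cherednik algebra of a subgroup extends to `H_c(W)` when the group
action extends compatibly. -/
theorem exists_lift_extend
    (hc0 : ∀ s : W, IsReflection (s : V ≃ₗᵢ[ℂ] V) → (s : V ≃ₗᵢ[ℂ] V) ∉ W' → c s = 0)
    {B : Type*} [Ring B] [Algebra ℂ B] (Λ : CherednikAlgebra W' (resParam hle c) →ₐ[ℂ] B)
    (R : W →* B) (hg : ∀ v : W', Λ (g W' _ v) = R (Subgroup.inclusion hle v))
    (hx : ∀ w f, R w * Λ (x W' _ f) * R w⁻¹ = Λ (x W' _ (dualAct w f)))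
    (hy : ∀ (w : W) v, R w * Λ (y W' _ v) * R w⁻¹ = Λ (y W' _ ((w : V ≃ₗᵢ[ℂ] V) v))) :
    ∃ ψ : CherednikAlgebra W c →ₐ[ℂ] B,
      (∀ f, ψ (x W c f) = Λ (x W' _ f)) ∧ (∀ v, ψ (y W c v) = Λ (y W' _ v)) ∧
      ∀ w, ψ (g W c w) = R w := by
  refine exists_lift c (Λ.toLinearMap ∘ₗ xLin (resParam hle c))
    (Λ.toLinearMap ∘ₗ yLin (resParam hle c)) R (fun f f' => ?_) (fun v v' => ?_)
    hx hy (fun v f => ?_)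
  · change Λ (x W' _ f) * Λ (x W' _ f') = Λ (x W' _ f') * Λ (x W' _ f)
    rw [← map_mul, x_comm, map_mul]
  · change Λ (y W' _ v) * Λ (y W' _ v') = Λ (y W' _ v') * Λ (y W' _ v)
    rw [← map_mul, y_comm, map_mul]
  · change Λ (y W' _ v) * Λ (x W' _ f) - Λ (x W' _ f) * Λ (y W' _ v) = _
    rw [← map_mul, ← map_mul, ← map_sub, y_mul_x_sub, map_add, map_sum, AlgHom.commutes]
    simp only [map_smul, hg]
    rw [sum_reflWeight_inclusion hle c hc0 (fun w => R w) v f]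

include hn in
/-- The Cherednik algebra of a normal subgroup which contains all reflections of nonzero parameter
embeds in the Cherednik algebra of the group. -/
theorem exists_injective_algHom
    (hc : ∀ w s : W, IsReflection (s : V ≃ₗᵢ[ℂ] V) → c (w * s * w⁻¹) = c s)
    (hc0 : ∀ s : W, IsReflection (s : V ≃ₗᵢ[ℂ] V) → (s : V ≃ₗᵢ[ℂ] V) ∉ W' → c s = 0) :
    ∃ φ : CherednikAlgebra W' (resParam hle c) →ₐ[ℂ] CherednikAlgebra W c,
      (∀ f, φ (x W' _ f) = x W c f) ∧ (∀ v, φ (y W' _ v) = y W c v) ∧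
      (∀ w, φ (g W' _ w) = g W c (Subgroup.inclusion hle w)) ∧ Function.Injective φ := by
  obtain ⟨θ, hθx, hθy, hθg, hθ, hθ1, hθin⟩ := exists_conj_action hn hle c hc
  obtain ⟨B, _, _, Λ, R, hΛ, hΛg, hRΛ⟩ := exists_faithful_rep hn hle c θ hθg hθ hθ1 hθin
  obtain ⟨ψ, hψx, hψy, hψg⟩ := exists_lift_extend hle c hc0 Λ R hΛg
    (fun w f => by rw [hRΛ, hθx]) (fun w v => by rw [hRΛ, hθy])
  have hφ : ∃ φ : CherednikAlgebra W' (resParam hle c) →ₐ[ℂ] CherednikAlgebra W c,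
      (∀ f, φ (x W' _ f) = x W c f) ∧ (∀ v, φ (y W' _ v) = y W c v) ∧
      (∀ w, φ (g W' _ w) = g W c (Subgroup.inclusion hle w)) := by
    refine exists_lift (resParam hle c) (xLin c) (yLin c)
      ((g W c).comp (Subgroup.inclusion hle)) (x_comm c) (y_comm c)
      (fun w f => g_mul_x_mul_g_inv c (Subgroup.inclusion hle w) f)
      (fun w v => g_mul_y_mul_g_inv c (Subgroup.inclusion hle w) v) (fun v f => ?_)
    change y W c v * x W c f - x W c f * y W c v = _
    rw [y_mul_x_sub, ← sum_reflWeight_inclusion hle c hc0 (fun w => g W c w) v f]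
    rfl
  obtain ⟨φ, hφx, hφy, hφg⟩ := hφ
  refine ⟨φ, hφx, hφy, hφg, ?_⟩
  -- The faithful representation Λ factors through φ, so φ is injective.
  have h : ψ.comp φ = Λ := by
    refine algHom_ext (resParam hle c) (φ := ψ.comp φ) (ψ := Λ) (fun f => ?_) (fun v => ?_) (fun w => ?_)
    · rw [AlgHom.comp_apply, hφx, hψx]
    · rw [AlgHom.comp_apply, hφy, hψy]
    · rw [AlgHom.comp_apply, hφg, hψg, hΛg]
  rw [← h, AlgHom.coe_comp] at hΛ
  exact hΛ.of_comp

end Subgroup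

end CherednikAlgebra

/-! ### Dunkl operators on polynomials and nonvanishing of the algebra. -/

namespace Dunkl

variable {n : ℕ}

/-- The linear polynomial of a linear form. -/
def linPoly : Module.Dual ℂ (Cn n) →ₗ[ℂ] MvPolynomial (Fin n) ℂ where
  toFun f := ∑ i, f (stdVec i) • MvPolynomial.X i
  map_add' f f' := by simp [add_smul, Finset.sum_add_distrib]
  map_smul' a f := by simp [Finset.smul_sum, smul_smul]

theorem linPoly_apply (f : Module.Dual ℂ (Cn n)) :
    linPoly f = ∑ i, f (stdVec i) • MvPolynomial.X i := rfl

theorem sum_smul_stdVec (v : Cn n) : ∑ i, v i • stdVec i = v := by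
  ext j
  simp [Pi.single_apply]

theorem sum_mul_apply_stdVec (f : Module.Dual ℂ (Cn n)) (v : Cn n) :
    ∑ i, f (stdVec i) * v i = f v := by
  conv_rhs => rw [← sum_smul_stdVec v, map_sum]
  exact Finset.sum_congr rfl fun i _ => by rw [map_smul, smul_eq_mul, mul_comm]

theorem eval_linPoly (f : Module.Dual ℂ (Cn n)) (v : Cn n) :
    MvPolynomial.eval v.ofLp (linPoly f) = f v := by
  rw [← sum_mul_apply_stdVec, linPoly_apply, map_sum]
  exact Finset.sum_congr rfl fun i _ => by rw [MvPolynomial.smul_eval, MvPolynomial.eval_X]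

/-- The coordinate functions. -/
def coord (i : Fin n) : Module.Dual ℂ (Cn n) :=
  (EuclideanSpace.proj i : Cn n →L[ℂ] ℂ)

@[simp]
theorem coord_apply (i : Fin n) (v : Cn n) : coord i v = v i := rfl

@[simp]
theorem linPoly_coord (i : Fin n) : linPoly (coord i) = MvPolynomial.X i := by
  rw [linPoly_apply, Finset.sum_eq_single i]
  · simp
  · intro j _ hj
    simp [hj.symm]
  · simp

theorem sum_smul_coord (f : Module.Dual ℂ (Cn n)) : ∑ i, f (stdVec i) • coord i = f := by
  ext v
  simp only [LinearMap.sum_apply, LinearMap.smul_apply, coord_apply, smul_eq_mul]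
  exact sum_mul_apply_stdVec f v

/-- Precomposition of linear forms with the inverse of a transformation. -/
abbrev dualMap (u : Cn n ≃ₗᵢ[ℂ] Cn n) (f : Module.Dual ℂ (Cn n)) : Module.Dual ℂ (Cn n) :=
  f ∘ₗ (u⁻¹).toLinearEquiv.toLinearMap

/-- The action of unitary transformations on polynomial functions. -/
def act (u : Cn n ≃ₗᵢ[ℂ] Cn n) : MvPolynomial (Fin n) ℂ →ₐ[ℂ] MvPolynomial (Fin n) ℂ :=
  MvPolynomial.aeval fun i => linPoly (dualMap u (coord i))

theorem act_linPoly (u : Cn n ≃ₗᵢ[ℂ] Cn n) (f : Module.Dual ℂ (Cn n)) :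
    act u (linPoly f) = linPoly (dualMap u f) := by
  conv_rhs => rw [← sum_smul_coord f]
  have h : dualMap u (∑ i, f (stdVec i) • coord i) = ∑ i, f (stdVec i) • dualMap u (coord i) := by
    ext v
    simp [dualMap]
  rw [h, map_sum, linPoly_apply, map_sum]
  exact Finset.sum_congr rfl fun i _ => by
    rw [map_smul, map_smul, act, MvPolynomial.aeval_X]

theorem act_mul (u v : Cn n ≃ₗᵢ[ℂ] Cn n) : act (u * v) = (act u).comp (act v) := by
  refine MvPolynomial.algHom_ext fun i => ?_
  rw [AlgHom.comp_apply, ← linPoly_coord, act_linPoly, act_linPoly, act_linPoly]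
  congr 1

theorem act_one : act (1 : Cn n ≃ₗᵢ[ℂ] Cn n) = AlgHom.id ℂ _ := by
  refine MvPolynomial.algHom_ext fun i => ?_
  rw [← linPoly_coord, act_linPoly, AlgHom.id_apply]
  congr 1

theorem act_act_inv (u : Cn n ≃ₗᵢ[ℂ] Cn n) (p : MvPolynomial (Fin n) ℂ) :
    act u (act u⁻¹ p) = p := by
  rw [← AlgHom.comp_apply, ← act_mul, mul_inv_cancel, act_one, AlgHom.id_apply]

theorem act_inv_act (u : Cn n ≃ₗᵢ[ℂ] Cn n) (p : MvPolynomial (Fin n) ℂ) :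
    act u⁻¹ (act u p) = p := by
  rw [← AlgHom.comp_apply, ← act_mul, inv_mul_cancel, act_one, AlgHom.id_apply]

/-- An operator is determined by its value at `1` and its commutators with linear forms. -/
theorem operator_ext {S T : Module.End ℂ (MvPolynomial (Fin n) ℂ)} (h1 : S 1 = T 1)
    (h : ∀ (f : Module.Dual ℂ (Cn n)) p, S p = T p → S (linPoly f * p) = T (linPoly f * p)) :
    S = T := by
  refine LinearMap.ext fun p => ?_
  induction p using MvPolynomial.induction_on with
  | C a => rw [MvPolynomial.C_eq_smul_one, map_smul, map_smul, h1]
  | add p q hp hq => rw [map_add, map_add, hp, hq]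
  | mul_X p i hp =>
    rw [mul_comm, ← linPoly_coord]
    exact h _ _ hp

theorem fixedSpace_inv (s : Cn n ≃ₗᵢ[ℂ] Cn n) : fixedSpace s⁻¹ = fixedSpace s := by
  ext v
  rw [mem_fixedSpace, mem_fixedSpace]
  change s.symm v = v ↔ s v = v
  rw [LinearIsometryEquiv.symm_apply_eq, eq_comm]

/-- A reflection changes linear forms by a multiple of the root. -/
theorem exists_sub_dualMap {s : Cn n ≃ₗᵢ[ℂ] Cn n} (hs : IsReflection s) :
    ∃ k : ℂ, k ≠ 0 ∧ ∀ (f : Module.Dual ℂ (Cn n)) (v : Cn n), v ∈ (fixedSpace s)ᗮ → v ≠ 0 →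
      f - dualMap s f = (k * f v / inner ℂ v v) • (innerSL ℂ v : Cn n →ₗ[ℂ] ℂ) := by
  have hs' : IsReflection s⁻¹ := by
    unfold IsReflection at *
    rwa [fixedSpace_inv]
  obtain ⟨k, hk, h⟩ := hs'.exists_sub_apply
  refine ⟨k, hk, fun f v hv h0 => ?_⟩
  refine LinearMap.ext fun z => ?_
  change f z - f (s⁻¹ z) = (k * f v / inner ℂ v v) * inner ℂ v z
  rw [← map_sub, h, hs'.rootProj_apply (by rwa [fixedSpace_inv]) h0, map_smul, map_smul,
    smul_eq_mul, smul_eq_mul]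
  ring

/-- The divided difference operator of a reflection. -/
theorem exists_rootOperator {s : Cn n ≃ₗᵢ[ℂ] Cn n} (hs : IsReflection s) (y : Cn n) :
    ∃ E : Module.End ℂ (MvPolynomial (Fin n) ℂ), E 1 = 0 ∧
      ∀ f p, E (linPoly f * p) = linPoly f * E p + f (rootProj s y) • act s p := by
  obtain ⟨hv, h0⟩ := normal_spec hs.fixedSpace_ne_top
  obtain ⟨k, hk, hf⟩ := exists_sub_dualMap hs
  set v := normal (fixedSpace s)
  have hf' := fun f => hf f v hv h0
  set α : MvPolynomial (Fin n) ℂ := linPoly (innerSL ℂ v : Cn n →ₗ[ℂ] ℂ) with hα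
  have hα0 : α ≠ 0 := by
    intro h
    have h1 := eval_linPoly (innerSL ℂ v : Cn n →ₗ[ℂ] ℂ) v
    rw [← hα, h, map_zero] at h1
    exact h0 (inner_self_eq_zero (𝕜 := ℂ).1 h1.symm)
  have hdiff : ∀ f, linPoly f - act s (linPoly f) = (k * f v / inner ℂ v v) • α := by
    intro f
    rw [act_linPoly, ← map_sub, hf', map_smul]
  -- Modulo α the reflection fixes every linear form, hence every polynomial.
  have hdvd : ∀ p, α ∣ p - act s p := by
    intro p
    rw [← Ideal.mem_span_singleton, ← Ideal.Quotient.mk_eq_mk_iff_sub_mem]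
    have h : (Ideal.Quotient.mkₐ ℂ (Ideal.span {α})) =
        (Ideal.Quotient.mkₐ ℂ (Ideal.span {α})).comp (act s) := by
      refine MvPolynomial.algHom_ext fun i => ?_
      rw [AlgHom.comp_apply, Ideal.Quotient.mkₐ_eq_mk, Ideal.Quotient.mk_eq_mk_iff_sub_mem,
        ← linPoly_coord, hdiff, Ideal.mem_span_singleton]
      exact dvd_smul_of_dvd _ dvd_rfl
    exact DFunLike.congr_fun h p
  -- The quotient (p - s p)/α; linearity and the product rule follow by cancelling α.
  choose Δ hΔ using hdvd
  let D : Module.End ℂ (MvPolynomial (Fin n) ℂ) :=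
    { toFun := Δ
      map_add' := fun p q => mul_left_cancel₀ hα0 (by
        rw [mul_add, ← hΔ, ← hΔ, ← hΔ, map_add]
        ring)
      map_smul' := fun a p => mul_left_cancel₀ hα0 (by
        rw [RingHom.id_apply, mul_smul_comm, ← hΔ, ← hΔ, map_smul, smul_sub]) }
  have hD : ∀ p, α * D p = p - act s p := fun p => (hΔ p).symm
  -- The scalar turns the factor k f(v)/⟨v,v⟩ in the product rule of D into f(v)⟨v,y⟩/⟨v,v⟩ =
  -- f(`rootProj s y`).
  refine ⟨(inner ℂ v y / k) • D, ?_, fun f p => ?_⟩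
  · have h : D 1 = 0 := mul_left_cancel₀ hα0 (by rw [hD, map_one, sub_self, mul_zero])
    rw [LinearMap.smul_apply, h, smul_zero]
  · have h : D (linPoly f * p) = linPoly f * D p + (k * f v / inner ℂ v v) • act s p := by
      refine mul_left_cancel₀ hα0 ?_
      rw [hD, mul_add, mul_left_comm, hD, mul_smul_comm, ← smul_mul_assoc, ← hdiff, map_mul]
      ring
    have hvv : (inner ℂ v v : ℂ) ≠ 0 := inner_self_ne_zero.2 h0
    rw [LinearMap.smul_apply, LinearMap.smul_apply, h, smul_add, mul_smul_comm, smul_smul,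
      hs.rootProj_apply hv h0, map_smul, smul_eq_mul]
    congr 2
    field_simp

variable {W : Subgroup (Cn n ≃ₗᵢ[ℂ] Cn n)} [Fintype W] (c : W → ℂ)

/-- The characterization of the Dunkl operator in direction `y`: it kills `1`, and its commutators
with linear forms are those of the Cherednik algebra. -/
structure IsDunkl (y : Cn n) (T : Module.End ℂ (MvPolynomial (Fin n) ℂ)) : Prop where
  apply_one : T 1 = 0
  apply_mul : ∀ f p, T (linPoly f * p) = linPoly f * T p + f y • p +
    ∑ w : W, (reflWeight c w * f (rootProj (w : Cn n ≃ₗᵢ[ℂ] Cn n) y)) •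
      act (w : Cn n ≃ₗᵢ[ℂ] Cn n) p

/-- The operator is the directional derivative along y plus weighted divided differences, one for
each reflection. -/
theorem exists_isDunkl (y : Cn n) : ∃ T, IsDunkl c y T := by
  have h : ∀ w : W, ∃ E : Module.End ℂ (MvPolynomial (Fin n) ℂ), E 1 = 0 ∧
      ∀ f p, E (linPoly f * p) = linPoly f * E p +
        (reflWeight c w * f (rootProj (w : Cn n ≃ₗᵢ[ℂ] Cn n) y)) •
          act (w : Cn n ≃ₗᵢ[ℂ] Cn n) p := by
    intro w
    by_cases hw : IsReflection (w : Cn n ≃ₗᵢ[ℂ] Cn n)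
    · obtain ⟨E, h1, h2⟩ := exists_rootOperator hw y
      refine ⟨reflWeight c w • E, by rw [LinearMap.smul_apply, h1, smul_zero], fun f p => ?_⟩
      rw [LinearMap.smul_apply, LinearMap.smul_apply, h2, smul_add, mul_smul_comm, smul_smul]
    · refine ⟨0, rfl, fun f p => ?_⟩
      simp [reflWeight, hw]
  choose E hE1 hE using h
  let D : Derivation ℂ (MvPolynomial (Fin n) ℂ) (MvPolynomial (Fin n) ℂ) :=
    MvPolynomial.mkDerivation ℂ fun i => MvPolynomial.C (y i)
  have hD : ∀ f, D (linPoly f) = MvPolynomial.C (f y) := by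
    intro f
    rw [linPoly_apply, map_sum, ← sum_mul_apply_stdVec, map_sum]
    refine Finset.sum_congr rfl fun i _ => ?_
    rw [Derivation.map_smul, MvPolynomial.mkDerivation_X, MvPolynomial.smul_eq_C_mul, map_mul]
  refine ⟨(D : Module.End ℂ (MvPolynomial (Fin n) ℂ)) + ∑ w, E w, ?_, fun f p => ?_⟩
  · simp [LinearMap.sum_apply, hE1]
  · simp only [LinearMap.add_apply, LinearMap.sum_apply, hE, Finset.sum_add_distrib, mul_add,
      Finset.mul_sum, Derivation.coeFn_coe, Derivation.leibniz, hD, smul_eq_mul]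
    rw [MvPolynomial.smul_eq_C_mul p (f y)]
    ring

variable {c}

theorem IsDunkl.unique {y : Cn n} {S T : Module.End ℂ (MvPolynomial (Fin n) ℂ)}
    (hS : IsDunkl c y S) (hT : IsDunkl c y T) : S = T :=
  operator_ext (hS.apply_one.trans hT.apply_one.symm) fun f p h => by
    rw [hS.apply_mul, hT.apply_mul, h]

theorem IsDunkl.add {y z : Cn n} {S T : Module.End ℂ (MvPolynomial (Fin n) ℂ)}
    (hS : IsDunkl c y S) (hT : IsDunkl c z T) : IsDunkl c (y + z) (S + T) where
  apply_one := by rw [LinearMap.add_apply, hS.apply_one, hT.apply_one, add_zero]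
  apply_mul f p := by
    simp only [LinearMap.add_apply, hS.apply_mul, hT.apply_mul, map_add, mul_add, add_smul,
      Finset.sum_add_distrib]
    abel

theorem IsDunkl.smul (a : ℂ) {y : Cn n} {T : Module.End ℂ (MvPolynomial (Fin n) ℂ)}
    (hT : IsDunkl c y T) : IsDunkl c (a • y) (a • T) where
  apply_one := by rw [LinearMap.smul_apply, hT.apply_one, smul_zero]
  apply_mul f p := by
    simp only [LinearMap.smul_apply, hT.apply_mul, map_smul, smul_add, Finset.smul_sum, smul_smul,
      mul_smul_comm, smul_eq_mul, mul_left_comm a]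

/-- With `IsDunkl.unique`, this gives the relation w T_y w⁻¹ = T_{wy} without computing with divided
differences. -/
theorem IsDunkl.conj
    (hc : ∀ w s : W, IsReflection (s : Cn n ≃ₗᵢ[ℂ] Cn n) → c (w * s * w⁻¹) = c s)
    {y : Cn n} {T : Module.End ℂ (MvPolynomial (Fin n) ℂ)} (hT : IsDunkl c y T) (u : W) :
    IsDunkl c ((u : Cn n ≃ₗᵢ[ℂ] Cn n) y)
      ((act (u : Cn n ≃ₗᵢ[ℂ] Cn n)).toLinearMap ∘ₗ T ∘ₗ
        (act (u : Cn n ≃ₗᵢ[ℂ] Cn n)⁻¹).toLinearMap) where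
  apply_one := by simp [hT.apply_one]
  apply_mul f p := by
    have hn : ∀ u ∈ W, ∀ v ∈ W, u * v * u⁻¹ ∈ W := fun u hu v hv =>
      W.mul_mem (W.mul_mem hu hv) (W.inv_mem hu)
    simp only [LinearMap.comp_apply, AlgHom.toLinearMap_apply]
    have h1 : act (u : Cn n ≃ₗᵢ[ℂ] Cn n)⁻¹ (linPoly f * p) =
        linPoly (dualMap (u : Cn n ≃ₗᵢ[ℂ] Cn n)⁻¹ f) * act (u : Cn n ≃ₗᵢ[ℂ] Cn n)⁻¹ p := by
      rw [map_mul, act_linPoly]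
    have h2 : ∀ z, dualMap (u : Cn n ≃ₗᵢ[ℂ] Cn n)⁻¹ f z = f ((u : Cn n ≃ₗᵢ[ℂ] Cn n) z) := by
      intro z
      simp [dualMap]
    have h3 : ∀ w : W, reflWeight c (CherednikAlgebra.conjEquiv hn u w) = reflWeight c w :=
      CherednikAlgebra.reflWeight_conj hn le_rfl c hc u
    have h4 : ∑ w : W, (reflWeight c w * f ((u : Cn n ≃ₗᵢ[ℂ] Cn n)
          (rootProj (w : Cn n ≃ₗᵢ[ℂ] Cn n) y))) • act (u : Cn n ≃ₗᵢ[ℂ] Cn n)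
            (act (w : Cn n ≃ₗᵢ[ℂ] Cn n) (act (u : Cn n ≃ₗᵢ[ℂ] Cn n)⁻¹ p)) =
        ∑ w : W, (reflWeight c w * f (rootProj (w : Cn n ≃ₗᵢ[ℂ] Cn n)
          ((u : Cn n ≃ₗᵢ[ℂ] Cn n) y))) • act (w : Cn n ≃ₗᵢ[ℂ] Cn n) p := by
      refine Fintype.sum_equiv (CherednikAlgebra.conjEquiv hn u).toEquiv _ _ fun w => ?_
      have h5 : (CherednikAlgebra.conjEquiv hn u).toEquiv w = CherednikAlgebra.conjEquiv hn u w :=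
        rfl
      rw [h5, h3, CherednikAlgebra.coe_conjEquiv, rootProj_conj, act_mul,
        act_mul, AlgHom.comp_apply, AlgHom.comp_apply]
    rw [h1, hT.apply_mul, map_add, map_add, map_mul, map_smul, act_act_inv, map_sum, ← act_linPoly,
      act_act_inv, h2, ← h4]
    simp only [map_smul, h2]

/-- Dunkl operators commute. -/
theorem IsDunkl.comm
    (hc : ∀ w s : W, IsReflection (s : Cn n ≃ₗᵢ[ℂ] Cn n) → c (w * s * w⁻¹) = c s)
    (T : Cn n →ₗ[ℂ] Module.End ℂ (MvPolynomial (Fin n) ℂ)) (hT : ∀ y, IsDunkl c y (T y))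
    (y z : Cn n) : T y * T z = T z * T y := by
  have hact : ∀ (u : W) (y : Cn n) p, act (u : Cn n ≃ₗᵢ[ℂ] Cn n) (T y p) =
      T ((u : Cn n ≃ₗᵢ[ℂ] Cn n) y) (act (u : Cn n ≃ₗᵢ[ℂ] Cn n) p) := by
    intro u y p
    rw [(hT ((u : Cn n ≃ₗᵢ[ℂ] Cn n) y)).unique ((hT y).conj hc u)]
    simp only [LinearMap.comp_apply, AlgHom.toLinearMap_apply, act_inv_act]
  -- By equivariance T_y w - w T_y = T_{y - wy} w, and y - wy is k times the root projection of y.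
  -- Proportionality of the projections of y and z then makes the contribution of each w symmetric.
  have key : ∀ (w : W) (f : Module.Dual ℂ (Cn n)) (p : MvPolynomial (Fin n) ℂ),
      (reflWeight c w * f (rootProj (w : Cn n ≃ₗᵢ[ℂ] Cn n) z)) •
          T y (act (w : Cn n ≃ₗᵢ[ℂ] Cn n) p) +
        (reflWeight c w * f (rootProj (w : Cn n ≃ₗᵢ[ℂ] Cn n) y)) •
          act (w : Cn n ≃ₗᵢ[ℂ] Cn n) (T z p) =
      (reflWeight c w * f (rootProj (w : Cn n ≃ₗᵢ[ℂ] Cn n) y)) •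
          T z (act (w : Cn n ≃ₗᵢ[ℂ] Cn n) p) +
        (reflWeight c w * f (rootProj (w : Cn n ≃ₗᵢ[ℂ] Cn n) z)) •
          act (w : Cn n ≃ₗᵢ[ℂ] Cn n) (T y p) := by
    intro w f p
    by_cases hw : IsReflection (w : Cn n ≃ₗᵢ[ℂ] Cn n)
    · obtain ⟨k, -, hk⟩ := hw.exists_sub_apply
      have h1 : ∀ y p, T y (act (w : Cn n ≃ₗᵢ[ℂ] Cn n) p) -
          act (w : Cn n ≃ₗᵢ[ℂ] Cn n) (T y p) =
          k • T (rootProj (w : Cn n ≃ₗᵢ[ℂ] Cn n) y) (act (w : Cn n ≃ₗᵢ[ℂ] Cn n) p) := by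
        intro y p
        rw [hact, ← LinearMap.sub_apply, ← map_sub, hk, map_smul, LinearMap.smul_apply]
      have h2 := congrArg (fun v => T v (act (w : Cn n ≃ₗᵢ[ℂ] Cn n) p))
        (hw.rootProj_proportional f y z)
      simp only [map_smul, LinearMap.smul_apply] at h2
      linear_combination (norm := module)
        (reflWeight c w * f (rootProj (w : Cn n ≃ₗᵢ[ℂ] Cn n) z)) • h1 y p -
          (reflWeight c w * f (rootProj (w : Cn n ≃ₗᵢ[ℂ] Cn n) y)) • h1 z p -
          (reflWeight c w * k) • h2
    · simp [reflWeight, hw]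
  -- Both products kill 1, and by `key` they have the same commutators with linear forms.
  refine operator_ext ?_ fun f p h => ?_
  · rw [Module.End.mul_apply, Module.End.mul_apply, (hT _).apply_one, (hT _).apply_one, map_zero,
      map_zero]
  · simp only [Module.End.mul_apply] at h ⊢
    rw [(hT z).apply_mul, (hT y).apply_mul]
    simp only [map_add, map_smul, map_sum, (hT z).apply_mul, (hT y).apply_mul, h]
    have := Finset.sum_congr (rfl : (Finset.univ : Finset W) = Finset.univ)
      fun w _ => key w f p
    rw [Finset.sum_add_distrib, Finset.sum_add_distrib] at this
    linear_combination this

end Dunkl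

namespace CherednikAlgebra

/-- The rational Cherednik algebra is nonzero: it acts on polynomials by Dunkl operators. -/
theorem nontrivial {n : ℕ} {W : Subgroup (Cn n ≃ₗᵢ[ℂ] Cn n)} [Fintype W] {c : W → ℂ}
    (hc : ∀ w s : W, IsReflection (s : Cn n ≃ₗᵢ[ℂ] Cn n) → c (w * s * w⁻¹) = c s) :
    Nontrivial (CherednikAlgebra W c) := by
  choose T₀ hT₀ using Dunkl.exists_isDunkl c
  let T : Cn n →ₗ[ℂ] Module.End ℂ (MvPolynomial (Fin n) ℂ) :=
    { toFun := T₀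
      map_add' := fun y z => (hT₀ _).unique ((hT₀ y).add (hT₀ z))
      map_smul' := fun a y => (hT₀ _).unique ((hT₀ y).smul a) }
  have hT : ∀ y, Dunkl.IsDunkl c y (T y) := hT₀
  let G : W →* Module.End ℂ (MvPolynomial (Fin n) ℂ) :=
    { toFun := fun w => (Dunkl.act (w : Cn n ≃ₗᵢ[ℂ] Cn n)).toLinearMap
      map_one' := by
        rw [Subgroup.coe_one, Dunkl.act_one]
        rfl
      map_mul' := fun w w' => by
        rw [Subgroup.coe_mul, Dunkl.act_mul]
        rfl }
  have hG : ∀ w p, G w p = Dunkl.act (w : Cn n ≃ₗᵢ[ℂ] Cn n) p := fun _ _ => rfl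
  obtain ⟨φ, -⟩ := exists_lift c
    ((LinearMap.mul ℂ (MvPolynomial (Fin n) ℂ)) ∘ₗ Dunkl.linPoly) T G
    (fun f f' => LinearMap.ext fun p => mul_left_comm _ _ _)
    (Dunkl.IsDunkl.comm hc T hT)
    (fun w f => LinearMap.ext fun p => by
      change Dunkl.act (w : Cn n ≃ₗᵢ[ℂ] Cn n) (Dunkl.linPoly f *
        Dunkl.act (w : Cn n ≃ₗᵢ[ℂ] Cn n)⁻¹ p) = Dunkl.linPoly (dualAct w f) * p
      rw [map_mul, Dunkl.act_act_inv, Dunkl.act_linPoly]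
      rfl)
    (fun w v => (((hT v).conj hc w).unique (hT _)))
    (fun v f => LinearMap.ext fun p => by
      change T v (Dunkl.linPoly f * p) - Dunkl.linPoly f * T v p = _
      rw [(hT v).apply_mul]
      simp only [LinearMap.add_apply, LinearMap.sum_apply, LinearMap.smul_apply, hG,
        Module.algebraMap_end_apply]
      ring)
  exact φ.toRingHom.domain_nontrivial

end CherednikAlgebra

/-! ### Structure of G(r,1,n), and G(r,p,n) as the kernel of a character. -/

section Monomial

variable {n : ℕ}

theorem isometry_ext {u v : Cn n ≃ₗᵢ[ℂ] Cn n} (h : ∀ j, u (stdVec j) = v (stdVec j)) : u = v := by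
  apply LinearIsometryEquiv.toLinearEquiv_injective
  apply LinearEquiv.toLinearMap_injective
  refine (EuclideanSpace.basisFun (Fin n) ℂ).toBasis.ext fun j => ?_
  simpa using h j

/-- The diagonal transformation with given entries. -/
def diagIso (u : Fin n → unitary ℂ) : Cn n ≃ₗᵢ[ℂ] Cn n :=
  LinearIsometryEquiv.piLpCongrRight 2 fun j => u j • LinearIsometryEquiv.refl ℂ ℂ

theorem diagIso_stdVec (u : Fin n → unitary ℂ) (j : Fin n) :
    diagIso u (stdVec j) = (u j : ℂ) • stdVec j := by
  ext i
  by_cases hij : i = j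
  · subst hij
    simp [diagIso]
  · simp [diagIso, hij]

theorem zeta_isPrimitiveRoot (r : ℕ) [NeZero r] : IsPrimitiveRoot (zeta r : ℂ) r :=
  Complex.isPrimitiveRoot_exp r (NeZero.ne r)

theorem coe_zeta_zpow (r : ℕ) (m : ℤ) : ((zeta r ^ m : unitary ℂ) : ℂ) = (zeta r : ℂ) ^ m := by
  cases m with
  | ofNat m => simp
  | negSucc m =>
    rw [zpow_negSucc, zpow_negSucc, ← SubmonoidClass.coe_pow]
    refine eq_inv_of_mul_eq_one_left ?_
    rw [← Submonoid.coe_mul, inv_mul_cancel, Submonoid.coe_one]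

/-- The diagonal transformations in `G(r,1,n)`, by their exponents. -/
def diagHom (r n : ℕ) [NeZero r] : Multiplicative (Fin n → ℤ) →* Gr1 r n where
  toFun m := ⟨diagIso fun j => zeta r ^ m.toAdd j, 1, fun j => (zeta r : ℂ) ^ m.toAdd j, fun j => by
    rw [← zpow_natCast, ← zpow_mul, mul_comm, zpow_mul, zpow_natCast,
      (zeta_isPrimitiveRoot r).pow_eq_one, one_zpow], fun j => by
    rw [diagIso_stdVec, coe_zeta_zpow]
    rfl⟩
  map_one' := Subtype.ext (isometry_ext fun j => by
    rw [diagIso_stdVec]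
    simp)
  map_mul' m m' := Subtype.ext (isometry_ext fun j => by
    rw [diagIso_stdVec, Subgroup.coe_mul, LinearIsometryEquiv.coe_mul, Function.comp_apply,
      diagIso_stdVec, map_smul, diagIso_stdVec, smul_smul, toAdd_mul, Pi.add_apply, zpow_add,
      Submonoid.coe_mul, mul_comm])

/-- The permutation transformations in `G(r,1,n)`. -/
def permHom (r n : ℕ) : Equiv.Perm (Fin n) →* Gr1 r n where
  toFun σ := ⟨permGen σ, permGen_mem r σ⟩
  map_one' := Subtype.ext (isometry_ext fun j => EuclideanSpace.piLpCongrLeft_single 1 j 1)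
  map_mul' σ τ := Subtype.ext (isometry_ext fun j => by
    rw [Subgroup.coe_mul, LinearIsometryEquiv.coe_mul, Function.comp_apply]
    exact (EuclideanSpace.piLpCongrLeft_single (σ * τ) j 1).trans
      ((congrArg (permGen σ) (EuclideanSpace.piLpCongrLeft_single τ j 1)).trans
        (EuclideanSpace.piLpCongrLeft_single σ (τ j) 1)).symm)

variable (r : ℕ) [NeZero r]

theorem coe_diagHom_stdVec (m : Multiplicative (Fin n → ℤ)) (j : Fin n) :
    (diagHom r n m : Cn n ≃ₗᵢ[ℂ] Cn n) (stdVec j) = (zeta r : ℂ) ^ m.toAdd j • stdVec j := by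
  rw [← coe_zeta_zpow]
  exact diagIso_stdVec _ j

omit [NeZero r] in
theorem coe_permHom_stdVec (σ : Equiv.Perm (Fin n)) (j : Fin n) :
    (permHom r n σ : Cn n ≃ₗᵢ[ℂ] Cn n) (stdVec j) = stdVec (σ j) :=
  EuclideanSpace.piLpCongrLeft_single σ j 1

/-- The semidirect product rule: permutations act on diagonal exponents by moving positions. -/
theorem permHom_mul_diagHom (σ : Equiv.Perm (Fin n)) (m : Fin n → ℤ) :
    permHom r n σ * diagHom r n (.ofAdd m) =
      diagHom r n (.ofAdd (m ∘ σ.symm)) * permHom r n σ := by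
  refine Subtype.ext (isometry_ext fun j => ?_)
  simp only [Subgroup.coe_mul, LinearIsometryEquiv.coe_mul, Function.comp_apply,
    coe_diagHom_stdVec, coe_permHom_stdVec, map_smul, toAdd_ofAdd, Equiv.symm_apply_apply]

theorem exists_eq_permHom_mul_diagHom (w : Gr1 r n) :
    ∃ (σ : Equiv.Perm (Fin n)) (m : Fin n → ℤ), w = permHom r n σ * diagHom r n (.ofAdd m) := by
  obtain ⟨w, σ, a, ha, hw⟩ := w
  choose m _ hm using fun j => (zeta_isPrimitiveRoot r).eq_pow_of_pow_eq_one (ha j)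
  refine ⟨σ, fun j => m j, Subtype.ext (isometry_ext fun j => ?_)⟩
  rw [Subgroup.coe_mul, LinearIsometryEquiv.coe_mul, Function.comp_apply, coe_diagHom_stdVec,
    map_smul, coe_permHom_stdVec]
  change w (stdVec j) = _
  rw [hw, ← hm, toAdd_ofAdd, zpow_natCast]

theorem S_zero [NeZero n] : S r n 0 = diagHom r n (.ofAdd (Pi.single 0 1)) := by
  refine Subtype.ext (isometry_ext fun j => ?_)
  rw [coe_diagHom_stdVec]
  have h : (S r n 0 : Cn n ≃ₗᵢ[ℂ] Cn n) = diagGen r n := by simp [S]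
  rw [h, toAdd_ofAdd]
  ext i
  by_cases hj : j = 0 <;> by_cases hij : i = j <;>
    simp [diagGen, stdVec, hj, hij]

omit [NeZero r] in
theorem S_castSucc_succ (r n : ℕ) [NeZero r] (i : Fin n) :
    S r (n + 1) i.succ = permHom r (n + 1) (Equiv.swap i.castSucc i.succ) := by
  unfold S
  rw [if_neg (by simp)]
  refine Subtype.ext ?_
  change permGen _ = permGen _
  congr 2

/-- The product of the nonzero entries of a monomial transformation. -/
def entryProd : Gr1 r n →* ℂ where
  toFun w := ∏ j, ∑ i, (w : Cn n ≃ₗᵢ[ℂ] Cn n) (stdVec j) i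
  map_one' := by simp
  map_mul' := by
    -- Each column has a single nonzero entry, so its coordinate sum is that entry.
    have key : ∀ (w : Cn n ≃ₗᵢ[ℂ] Cn n) (σ : Equiv.Perm (Fin n)) (a : Fin n → ℂ),
        (∀ j, w (stdVec j) = a j • stdVec (σ j)) → ∏ j, ∑ i, w (stdVec j) i = ∏ j, a j := by
      intro w σ a h
      refine Finset.prod_congr rfl fun j _ => ?_
      simp [h]
    rintro ⟨u, σ, a, ha, hu⟩ ⟨v, ρ, b, hb, hv⟩
    refine (key (u * v) (σ * ρ) (fun j => b j * a (ρ j)) fun j => ?_).trans (Eq.trans ?_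
      (congrArg₂ (· * ·) (key u σ a hu) (key v ρ b hv)).symm)
    rotate_left
    · rw [Finset.prod_mul_distrib, Equiv.prod_comp ρ a, mul_comm]
    · rw [LinearIsometryEquiv.coe_mul, Function.comp_apply, hv, map_smul, hu, smul_smul]
      rfl

omit [NeZero r] in
theorem entryProd_apply (w : Gr1 r n) :
    entryProd r w = ∏ j, ∑ i, (w : Cn n ≃ₗᵢ[ℂ] Cn n) (stdVec j) i := rfl

theorem entryProd_diagHom (m : Fin n → ℤ) :
    entryProd r (diagHom r n (.ofAdd m)) = (zeta r : ℂ) ^ ∑ j, m j := by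
  rw [entryProd_apply]
  have h0 : (zeta r : ℂ) ≠ 0 := (zeta_isPrimitiveRoot r).ne_zero (NeZero.ne r)
  have h : ∀ s : Finset (Fin n), ∏ j ∈ s, (zeta r : ℂ) ^ m j = (zeta r : ℂ) ^ ∑ j ∈ s, m j := by
    intro s
    induction s using Finset.induction_on with
    | empty => simp
    | insert a s ha ih => rw [Finset.prod_insert ha, Finset.sum_insert ha, ih, zpow_add₀ h0]
  rw [← h]
  refine Finset.prod_congr rfl fun j _ => ?_
  simp [coe_diagHom_stdVec]

theorem entryProd_permHom (σ : Equiv.Perm (Fin n)) : entryProd r (permHom r n σ) = 1 := by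
  rw [entryProd_apply]
  refine Finset.prod_eq_one fun j _ => ?_
  simp [coe_permHom_stdVec]

/-- The group `G(r,p,n)` as a subgroup of `G(r,1,n)`. -/
abbrev grpIn (r p n : ℕ) [NeZero r] [NeZero n] : Subgroup (Gr1 r n) :=
  Subgroup.closure ({S r n 0 ^ p} ∪
    {w | ∃ k : Fin n, k.val = 1 ∧ w = (S r n 0)⁻¹ * S r n k * S r n 0} ∪
    {w | ∃ k : Fin n, k ≠ 0 ∧ w = S r n k})

omit [NeZero r] in
theorem coe_mem_Grp (r p : ℕ) [NeZero r] [NeZero n] (w : Gr1 r n) :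
    (w : Cn n ≃ₗᵢ[ℂ] Cn n) ∈ Grp r p n ↔ w ∈ grpIn r p n :=
  Subgroup.mem_map_iff_mem (Subgroup.subtype_injective _)

/-- A subgroup which contains the generators `S_2, …, S_n` contains all permutations. -/
theorem permHom_mem {n : ℕ} [NeZero n] {K : Subgroup (Gr1 r n)}
    (hK : ∀ k : Fin n, k ≠ 0 → S r n k ∈ K) (σ : Equiv.Perm (Fin n)) : permHom r n σ ∈ K := by
  obtain ⟨m, rfl⟩ : ∃ m, n = m + 1 := ⟨n - 1, by have := NeZero.pos n; omega⟩
  have h : Submonoid.closure (Set.range fun i : Fin m => Equiv.swap i.castSucc i.succ) ≤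
      (K.comap (permHom r (m + 1))).toSubmonoid := by
    rw [Submonoid.closure_le]
    rintro _ ⟨i, rfl⟩
    change permHom r (m + 1) _ ∈ K
    rw [← S_castSucc_succ]
    exact hK _ (Fin.succ_ne_zero i)
  rw [Equiv.Perm.mclosure_swap_castSucc_succ] at h
  exact h (Submonoid.mem_top σ)

theorem exists_S_eq_permHom [NeZero n] (k : Fin n) (hk : k ≠ 0) :
    ∃ σ : Equiv.Perm (Fin n), S r n k = permHom r n σ := by
  refine ⟨Equiv.swap ⟨k.val - 1, by omega⟩ k, ?_⟩
  unfold S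
  rw [if_neg (fun h : k.val = 0 => hk (Fin.ext h))]
  rfl

variable (p : ℕ)

/-- Differences of diagonal exponents lie in `G(r,p,n)`. -/
theorem diagHom_single_sub_mem [NeZero n] (j : Fin n) :
    diagHom r n (.ofAdd (Pi.single j 1 - Pi.single 0 1)) ∈ grpIn r p n := by
  have hperm : ∀ σ, permHom r n σ ∈ grpIn r p n := permHom_mem r fun k hk =>
    Subgroup.subset_closure (Or.inr ⟨k, hk, rfl⟩)
  by_cases hj : j = 0
  · subst hj
    rw [sub_self, ofAdd_zero, map_one]
    exact one_mem _
  have hn : 1 < n := by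
    have := j.2
    have : j.val ≠ 0 := fun h => hj (Fin.ext h)
    omega
  let k : Fin n := ⟨1, hn⟩
  have hk0 : (0 : Fin n) ≠ k := fun h => by simpa [k] using congrArg Fin.val h
  have hSk : S r n k = permHom r n (Equiv.swap 0 k) := by
    unfold S
    rw [if_neg (by simp [k])]
    rfl
  have h1 : diagHom r n (.ofAdd (Pi.single k 1 - Pi.single 0 1)) ∈ grpIn r p n := by
    have h2 : (S r n 0)⁻¹ * S r n k * S r n 0 ∈ grpIn r p n :=
      Subgroup.subset_closure (Or.inl (Or.inr ⟨k, rfl, rfl⟩))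
    -- S_1⁻¹ S_2 S_1 S_2⁻¹ is diagonal with exponents -1 and 1 in the first two positions.
    have h3 := mul_mem h2 (inv_mem (hperm (Equiv.swap 0 k)))
    rw [hSk, S_zero, mul_assoc _ (permHom r n _), permHom_mul_diagHom, mul_assoc, mul_assoc,
      mul_inv_cancel, mul_one, ← map_inv, ← map_mul, ← ofAdd_neg, ← ofAdd_add] at h3
    convert h3 using 3
    ext i
    simp only [Pi.sub_apply, Pi.add_apply, Pi.neg_apply, Function.comp_apply, Equiv.symm_swap,
      Pi.single_apply, Equiv.swap_apply_def]
    split_ifs <;> simp_all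
  -- Conjugation by this swap moves the exponent 1 from position k to j and fixes position 0.
  have h4 := mul_mem (mul_mem (hperm (Equiv.swap k j)) h1) (inv_mem (hperm (Equiv.swap k j)))
  rw [permHom_mul_diagHom, mul_assoc, mul_inv_cancel, mul_one] at h4
  convert h4 using 3
  ext i
  simp only [Pi.sub_apply, Function.comp_apply, Equiv.symm_swap, Pi.single_apply,
    Equiv.swap_apply_def]
  split_ifs <;> simp_all

/-- The integer vectors of sum zero are generated by the differences e_j - e_0. -/
theorem diagHom_mem_of_sum_eq_zero [NeZero n] (m : Fin n → ℤ) (hm : ∑ j, m j = 0) :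
    diagHom r n (.ofAdd m) ∈ grpIn r p n := by
  let A : AddSubgroup (Fin n → ℤ) := Subgroup.toAddSubgroup' ((grpIn r p n).comap (diagHom r n))
  have hA : ∀ v, v ∈ A ↔ diagHom r n (.ofAdd v) ∈ grpIn r p n := fun v => Iff.rfl
  rw [← hA]
  have h : m = ∑ j, m j • (Pi.single j (1 : ℤ) - Pi.single 0 1 : Fin n → ℤ) := by
    simp only [smul_sub, Finset.sum_sub_distrib]
    rw [← Finset.sum_smul, hm, zero_smul, sub_zero]
    ext i
    simp [Finset.sum_apply, Pi.single_apply]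
  rw [h]
  exact sum_mem fun j _ => zsmul_mem ((hA _).2 (diagHom_single_sub_mem r p j)) _

/-- Every element of `G(r,1,n)` is the product of an element of `G(r,p,n)` and a power of `S_1`. -/
theorem exists_eq_mul_zpow [NeZero n] (w : Gr1 r n) :
    ∃ k ∈ grpIn r p n, ∃ i : ℤ, w = k * S r n 0 ^ i := by
  obtain ⟨σ, m, rfl⟩ := exists_eq_permHom_mul_diagHom r w
  -- Move the whole exponent sum to position 0, where it becomes a power of S_1.
  refine ⟨permHom r n σ * diagHom r n (.ofAdd (m - (∑ j, m j) • Pi.single 0 1)), mul_mem ?_ ?_,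
    ∑ j, m j, ?_⟩
  · exact permHom_mem r (fun k hk => Subgroup.subset_closure (Or.inr ⟨k, hk, rfl⟩)) σ
  · refine diagHom_mem_of_sum_eq_zero r p _ ?_
    simp [Pi.single_apply]
  · rw [mul_assoc, S_zero, ← map_zpow, ← map_mul, ← ofAdd_zsmul, ← ofAdd_add, sub_add_cancel]

/-- The standard generators generate `G(r,1,n)`. -/
theorem closure_range_S [NeZero n] : Subgroup.closure (Set.range (S r n)) = ⊤ := by
  have hS : ∀ k, S r n k ∈ Subgroup.closure (Set.range (S r n)) :=
    fun k => Subgroup.subset_closure ⟨k, rfl⟩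
  refine eq_top_iff.2 fun w _ => ?_
  obtain ⟨k, hk, i, rfl⟩ := exists_eq_mul_zpow r 1 w
  refine mul_mem ?_ (zpow_mem (hS 0) i)
  have h : grpIn r 1 n ≤ Subgroup.closure (Set.range (S r n)) := by
    rw [Subgroup.closure_le]
    rintro _ ((rfl | ⟨k, -, rfl⟩) | ⟨k, -, rfl⟩)
    · exact pow_mem (hS 0) _
    · exact mul_mem (mul_mem (inv_mem (hS 0)) (hS k)) (hS 0)
    · exact hS k
  exact h hk

/-- The linear character of `G(r,1,n)` with kernel `G(r,p,n)`. -/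
theorem exists_character [NeZero n] {p : ℕ} (hp : p ∣ r) {ξ : ℂ} (hξ : IsPrimitiveRoot ξ p) :
    ∃ χ : Gr1 r n →* ℂ, χ (S r n 0) = ξ ∧ (∀ k : Fin n, k ≠ 0 → χ (S r n k) = 1) ∧
      ∀ w : Gr1 r n, χ w = 1 ↔ (w : Cn n ≃ₗᵢ[ℂ] Cn n) ∈ Grp r p n := by
  -- Since p divides r, ξ is an r-th root of unity, so ξ = ζ^l; the character is the l-th power of
  -- `entryProd`.
  obtain ⟨l, -, hl⟩ := (zeta_isPrimitiveRoot r).eq_pow_of_pow_eq_one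
    ((hξ.pow_eq_one_iff_dvd r).2 hp)
  have h0 : (entryProd r ^ l : Gr1 r n →* ℂ) (S r n 0) = ξ := by
    rw [MonoidHom.pow_apply, S_zero, entryProd_diagHom]
    simp [hl]
  have h1 : ∀ k : Fin n, k ≠ 0 → (entryProd r ^ l : Gr1 r n →* ℂ) (S r n k) = 1 := by
    intro k hk
    obtain ⟨σ, hσ⟩ := exists_S_eq_permHom r k hk
    rw [MonoidHom.pow_apply, hσ, entryProd_permHom, one_pow]
  generalize (entryProd r ^ l : Gr1 r n →* ℂ) = χ at h0 h1
  have hker : grpIn r p n ≤ χ.ker := by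
    rw [Subgroup.closure_le]
    have hinv : χ (S r n 0)⁻¹ * χ (S r n 0) = 1 := by rw [← map_mul, inv_mul_cancel, map_one]
    rintro _ ((rfl | ⟨k, hk, rfl⟩) | ⟨k, hk, rfl⟩)
    · change χ _ = 1
      rw [map_pow, h0, hξ.pow_eq_one]
    · change χ _ = 1
      have hk0 : k ≠ 0 := by
        rintro rfl
        simp at hk
      rw [map_mul, map_mul, h1 k hk0, mul_one, hinv]
    · exact h1 k hk
  refine ⟨χ, h0, h1, fun w => ?_⟩
  rw [coe_mem_Grp]
  refine ⟨fun hw => ?_, fun hw => hker hw⟩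
  obtain ⟨k, hk, i, rfl⟩ := exists_eq_mul_zpow r p w
  have hk1 : χ k = 1 := hker hk
  rw [map_mul, hk1, one_mul, map_zpow, h0] at hw
  -- For w = k S_1^i the character value is ξ^i, so p divides i and S_1^i is a power of the
  -- generator S_1^p.
  obtain ⟨j, rfl⟩ := (hξ.zpow_eq_one_iff_dvd i).1 hw
  refine mul_mem hk ?_
  rw [zpow_mul, zpow_natCast]
  refine zpow_mem ?_ j
  exact Subgroup.subset_closure (Or.inl (Or.inl rfl))

end Monomial

/-! ### Twists by linear characters and their invariants. -/

namespace CherednikAlgebra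

section Twist

/-- The twist of a homomorphism from a group to an algebra by a linear character. -/
def twistHom {G A : Type*} [Group G] [Ring A] [Algebra ℂ A] (χ : G →* ℂˣ) (γ : G →* A) :
    G →* A where
  toFun w := (χ w : ℂ) • γ w
  map_one' := by rw [map_one, map_one, Units.val_one, one_smul]
  map_mul' w w' := by rw [map_mul, map_mul, Units.val_mul, smul_mul_smul_comm]

theorem twistHom_apply {G A : Type*} [Group G] [Ring A] [Algebra ℂ A] (χ : G →* ℂˣ) (γ : G →* A)
    (w : G) : twistHom χ γ w = (χ w : ℂ) • γ w := rfl

theorem monoidAlgebra_ext {G A : Type*} [Group G] [Ring A] [Algebra ℂ A]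
    {φ ψ : MonoidAlgebra ℂ G →ₐ[ℂ] A}
    (h : ∀ w, φ (MonoidAlgebra.of ℂ G w) = ψ (MonoidAlgebra.of ℂ G w)) : φ = ψ :=
  (MonoidAlgebra.lift ℂ A G).symm.injective (MonoidHom.ext h)

theorem algEquiv_pow_apply {A : Type*} [Ring A] [Algebra ℂ A] {τ : A ≃ₐ[ℂ] A} {z : ℂ} {a : A}
    (h : τ a = z • a) (i : ℕ) : (τ ^ i) a = z ^ i • a := by
  induction i with
  | zero => rw [pow_zero, pow_zero, one_smul, AlgEquiv.one_apply]
  | succ i ih => rw [pow_succ', AlgEquiv.mul_apply, ih, map_smul, h, smul_smul, pow_succ]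

/-- The automorphism of the group algebra given by a linear character. -/
theorem exists_groupAlg_twist {G : Type*} [Group G] (χ : G →* ℂˣ) :
    ∃ τ : MonoidAlgebra ℂ G ≃ₐ[ℂ] MonoidAlgebra ℂ G,
      ∀ w, τ (MonoidAlgebra.of ℂ G w) = (χ w : ℂ) • MonoidAlgebra.of ℂ G w := by
  let t : (G →* ℂˣ) → MonoidAlgebra ℂ G →ₐ[ℂ] MonoidAlgebra ℂ G := fun χ =>
    MonoidAlgebra.lift ℂ _ G (twistHom χ (MonoidAlgebra.of ℂ G))
  have ht : ∀ χ w, t χ (MonoidAlgebra.of ℂ G w) = (χ w : ℂ) • MonoidAlgebra.of ℂ G w :=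
    fun χ w => MonoidAlgebra.lift_of _ _
  have hinv : ∀ χ χ' : G →* ℂˣ, χ * χ' = 1 → (t χ).comp (t χ') = AlgHom.id ℂ _ := by
    intro χ χ' h
    refine monoidAlgebra_ext fun w => ?_
    change t χ (t χ' (MonoidAlgebra.of ℂ G w)) = MonoidAlgebra.of ℂ G w
    rw [ht, map_smul, ht, smul_smul, mul_comm, ← Units.val_mul, ← MonoidHom.mul_apply, h,
      MonoidHom.one_apply, Units.val_one, one_smul]
  exact ⟨AlgEquiv.ofAlgHom (t χ) (t χ⁻¹) (hinv _ _ (mul_inv_cancel χ)) (hinv _ _ (inv_mul_cancel χ)),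
    ht χ⟩

theorem groupAlg_twist_pow {G : Type*} [Group G] {χ : G →* ℂˣ} {p : ℕ} (hχ : χ ^ p = 1)
    {τ : MonoidAlgebra ℂ G ≃ₐ[ℂ] MonoidAlgebra ℂ G}
    (hτ : ∀ w, τ (MonoidAlgebra.of ℂ G w) = (χ w : ℂ) • MonoidAlgebra.of ℂ G w) : τ ^ p = 1 := by
  have h : (τ ^ p).toAlgHom = AlgHom.id ℂ _ := by
    refine monoidAlgebra_ext fun w => ?_
    refine (algEquiv_pow_apply (hτ w) p).trans ?_
    rw [← Units.val_pow_eq_pow_val, ← MonoidHom.pow_apply, hχ, MonoidHom.one_apply,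
      Units.val_one, one_smul, AlgHom.id_apply]
  exact AlgEquiv.ext fun a => DFunLike.congr_fun h a

variable {V : Type*} [NormedAddCommGroup V] [InnerProductSpace ℂ V] [FiniteDimensional ℂ V]
variable {W : Subgroup (V ≃ₗᵢ[ℂ] V)} [Fintype W] (c : W → ℂ)

/-- In w x w⁻¹ and w y w⁻¹ the scalars χ(w) and χ(w⁻¹) cancel; in [y,x] every term with nonzero
weight has χ(w) = 1. -/
theorem exists_twist_algHom (χ : W →* ℂˣ)
    (hχ : ∀ w : W, IsReflection (w : V ≃ₗᵢ[ℂ] V) → c w ≠ 0 → χ w = 1) :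
    ∃ τ : CherednikAlgebra W c →ₐ[ℂ] CherednikAlgebra W c,
      (∀ f, τ (x W c f) = x W c f) ∧ (∀ v, τ (y W c v) = y W c v) ∧
      ∀ w, τ (g W c w) = (χ w : ℂ) • g W c w := by
  have hχχ : ∀ w, ((χ w⁻¹ : ℂˣ) : ℂ) * (χ w : ℂ) = 1 := fun w => by
    rw [← Units.val_mul, ← map_mul, inv_mul_cancel, map_one, Units.val_one]
  refine exists_lift c (xLin c) (yLin c) (twistHom χ (g W c)) (x_comm c) (y_comm c)
    (fun w f => ?_) (fun w v => ?_) (fun v f => ?_)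
  · rw [twistHom_apply, twistHom_apply, smul_mul_assoc, smul_mul_assoc, mul_smul_comm, smul_smul,
      mul_comm, hχχ, one_smul]
    exact g_mul_x_mul_g_inv c w f
  · rw [twistHom_apply, twistHom_apply, smul_mul_assoc, smul_mul_assoc, mul_smul_comm, smul_smul,
      mul_comm, hχχ, one_smul]
    exact g_mul_y_mul_g_inv c w v
  · refine (y_mul_x_sub c v f).trans ?_
    congr 1
    refine Finset.sum_congr rfl fun w _ => ?_
    rw [twistHom_apply]
    by_cases h : IsReflection (w : V ≃ₗᵢ[ℂ] V) ∧ c w ≠ 0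
    · rw [hχ w h.1 h.2, Units.val_one, one_smul]
    · have h0 : reflWeight c w = 0 := by
        unfold reflWeight
        split_ifs with h1
        · by_contra h2
          exact h ⟨h1, h2⟩
        · rfl
      rw [h0, zero_mul, zero_smul, zero_smul]

/-- The automorphism of the Cherednik algebra given by a linear character which is trivial on the
reflections of nonzero parameter. -/
theorem exists_twist (χ : W →* ℂˣ)
    (hχ : ∀ w : W, IsReflection (w : V ≃ₗᵢ[ℂ] V) → c w ≠ 0 → χ w = 1) :
    ∃ τ : CherednikAlgebra W c ≃ₐ[ℂ] CherednikAlgebra W c,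
      (∀ f, τ (x W c f) = x W c f) ∧ (∀ v, τ (y W c v) = y W c v) ∧
      ∀ w, τ (g W c w) = (χ w : ℂ) • g W c w := by
  obtain ⟨t, htx, hty, htg⟩ := exists_twist_algHom c χ hχ
  obtain ⟨s, hsx, hsy, hsg⟩ := exists_twist_algHom c χ⁻¹ fun w h1 h2 => by
    rw [MonoidHom.inv_apply, hχ w h1 h2, inv_one]
  refine ⟨AlgEquiv.ofAlgHom t s (algHom_ext c (fun f => ?_) (fun v => ?_) fun w => ?_)
    (algHom_ext c (fun f => ?_) (fun v => ?_) fun w => ?_), htx, hty, htg⟩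
  · rw [AlgHom.comp_apply, hsx, htx, AlgHom.id_apply]
  · rw [AlgHom.comp_apply, hsy, hty, AlgHom.id_apply]
  · rw [AlgHom.comp_apply, hsg, map_smul, htg, smul_smul, ← Units.val_mul, MonoidHom.inv_apply,
      inv_mul_cancel, Units.val_one, one_smul, AlgHom.id_apply]
  · rw [AlgHom.comp_apply, htx, hsx, AlgHom.id_apply]
  · rw [AlgHom.comp_apply, hty, hsy, AlgHom.id_apply]
  · rw [AlgHom.comp_apply, htg, map_smul, hsg, smul_smul, ← Units.val_mul, MonoidHom.inv_apply,
      mul_inv_cancel, Units.val_one, one_smul, AlgHom.id_apply]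

variable {c} in
theorem twist_pow {χ : W →* ℂˣ} {p : ℕ} (hχ : χ ^ p = 1)
    {τ : CherednikAlgebra W c ≃ₐ[ℂ] CherednikAlgebra W c} (hx : ∀ f, τ (x W c f) = x W c f)
    (hy : ∀ v, τ (y W c v) = y W c v) (hg : ∀ w, τ (g W c w) = (χ w : ℂ) • g W c w) :
    τ ^ p = 1 := by
  have h : (τ ^ p).toAlgHom = AlgHom.id ℂ _ := by
    refine algHom_ext c (fun f => ?_) (fun v => ?_) fun w => ?_
    · refine (algEquiv_pow_apply (z := 1) (by rw [hx, one_smul]) p).trans ?_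
      rw [one_pow, one_smul, AlgHom.id_apply]
    · refine (algEquiv_pow_apply (z := 1) (by rw [hy, one_smul]) p).trans ?_
      rw [one_pow, one_smul, AlgHom.id_apply]
    · refine (algEquiv_pow_apply (hg w) p).trans ?_
      rw [← Units.val_pow_eq_pow_val, ← MonoidHom.pow_apply, hχ, MonoidHom.one_apply,
        Units.val_one, one_smul, AlgHom.id_apply]
  exact AlgEquiv.ext fun a => DFunLike.congr_fun h a

theorem g_ne_zero [Nontrivial (CherednikAlgebra W c)] (w : W) : g W c w ≠ 0 :=
  ((Group.isUnit w).map (g W c)).ne_zero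

/-- A subalgebra which contains the generators is everything. -/
theorem mem_of_generators_mem {A : Subalgebra ℂ (CherednikAlgebra W c)}
    (hx : ∀ f, x W c f ∈ A) (hy : ∀ v, y W c v ∈ A) (hg : ∀ w, g W c w ∈ A)
    (h : CherednikAlgebra W c) : h ∈ A := by
  obtain ⟨a, rfl⟩ := RingQuot.mkAlgHom_surjective ℂ (Rel W c) h
  change mk W c a ∈ A
  induction a using FreeAlgebra.induction with
  | grade0 r => exact (AlgHom.commutes (mk W c) r) ▸ A.algebraMap_mem r
  | grade1 a =>
    cases a with
    | x f => exact hx f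
    | y v => exact hy v
    | g w => exact hg w
  | mul a b ha hb => exact map_mul (mk W c) a b ▸ A.mul_mem ha hb
  | add a b ha hb => exact map_add (mk W c) a b ▸ A.add_mem ha hb

theorem g_mul_x (w : W) (f : Module.Dual ℂ V) :
    g W c w * x W c f = x W c (dualAct w f) * g W c w := by
  rw [← g_mul_x_mul_g_inv, mul_assoc, ← map_mul, inv_mul_cancel, map_one, mul_one]

theorem g_mul_y (w : W) (v : V) :
    g W c w * y W c v = y W c ((w : V ≃ₗᵢ[ℂ] V) v) * g W c w := by
  rw [← g_mul_y_mul_g_inv, mul_assoc, ← map_mul, inv_mul_cancel, map_one, mul_one]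

/-- If a subalgebra `A` contains `V` and `V^*`, then `H_c(W)` is spanned by the products `a w` with
`a ∈ A` and `w ∈ W`. -/
theorem mem_span_mul_g {A : Subalgebra ℂ (CherednikAlgebra W c)}
    (hx : ∀ f, x W c f ∈ A) (hy : ∀ v, y W c v ∈ A) (h : CherednikAlgebra W c) :
    h ∈ Submodule.span ℂ {b | ∃ a ∈ A, ∃ w, b = a * g W c w} := by
  set N := Submodule.span ℂ {b | ∃ a ∈ A, ∃ w, b = a * g W c w} with hN
  have hmem : ∀ a ∈ A, ∀ w, a * g W c w ∈ N := fun a ha w => Submodule.subset_span ⟨a, ha, w, rfl⟩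
  have hstab : ∀ b, (∀ a ∈ A, ∀ w, a * g W c w * b ∈ N) → ∀ m ∈ N, m * b ∈ N := by
    intro b hb m hm
    induction hm using Submodule.span_induction with
    | mem m hm =>
      obtain ⟨a, ha, w, rfl⟩ := hm
      exact hb a ha w
    | zero => rw [zero_mul]; exact N.zero_mem
    | add m m' _ _ h1 h2 => rw [add_mul]; exact N.add_mem h1 h2
    | smul a m _ h1 => rw [smul_mul_assoc]; exact N.smul_mem a h1
  -- The elements that preserve the span N under right multiplication form a subalgebra. It contains
  -- the generators, so it is everything, and 1 ∈ N finishes.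
  let R : Subalgebra ℂ (CherednikAlgebra W c) :=
    { carrier := {b | ∀ m ∈ N, m * b ∈ N}
      mul_mem' := fun {a b} ha hb m hm => by rw [← mul_assoc]; exact hb _ (ha m hm)
      add_mem' := fun {a b} ha hb m hm => by rw [mul_add]; exact N.add_mem (ha m hm) (hb m hm)
      algebraMap_mem' := fun r m hm => by
        rw [← Algebra.commutes, ← Algebra.smul_def]
        exact N.smul_mem r hm }
  have hR : h ∈ R := by
    refine mem_of_generators_mem c (fun f => ?_) (fun v => ?_) (fun u => ?_) h
    · refine hstab _ fun a ha w => ?_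
      rw [mul_assoc, g_mul_x, ← mul_assoc]
      exact hmem _ (A.mul_mem ha (hx _)) w
    · refine hstab _ fun a ha w => ?_
      rw [mul_assoc, g_mul_y, ← mul_assoc]
      exact hmem _ (A.mul_mem ha (hy _)) w
    · refine hstab _ fun a ha w => ?_
      rw [mul_assoc, ← map_mul]
      exact hmem _ ha _
  have h1 : (1 : CherednikAlgebra W c) ∈ N := by
    have := hmem 1 A.one_mem 1
    rwa [map_one, mul_one] at this
  simpa using hR 1 h1

/-- If an automorphism of order dividing `p` fixes a subalgebra `A` containing `V`, `V^*` and the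
kernel of the linear character by which it acts on `W`, then `A` is the subalgebra of invariants. -/
theorem mem_iff_apply_eq {A : Subalgebra ℂ (CherednikAlgebra W c)}
    (hx : ∀ f, x W c f ∈ A) (hy : ∀ v, y W c v ∈ A) {p : ℕ} (hp : p ≠ 0) {χ : W →* ℂˣ}
    (hχ : χ ^ p = 1) (hA : ∀ w, χ w = 1 → g W c w ∈ A)
    {τ : CherednikAlgebra W c ≃ₐ[ℂ] CherednikAlgebra W c} (hτA : ∀ a ∈ A, τ a = a)
    (hτ : ∀ w, τ (g W c w) = (χ w : ℂ) • g W c w) (h : CherednikAlgebra W c) :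
    h ∈ A ↔ τ h = h := by
  refine ⟨hτA h, fun hh => ?_⟩
  have hpow : ∀ (i : ℕ) a, a ∈ A → ∀ w, (τ ^ i) (a * g W c w) = (χ w : ℂ) ^ i • (a * g W c w) :=
    fun i a ha w => algEquiv_pow_apply (by rw [map_mul, hτA a ha, hτ, mul_smul_comm]) i
  -- On a w the sum is a geometric series in χ(w), a p-th root of unity: it vanishes unless χ(w) =
  -- 1, and then a w lies in A.
  have havg : ∀ b, ∑ i ∈ Finset.range p, (τ ^ i) b ∈ A := by
    intro b
    induction mem_span_mul_g c hx hy b using Submodule.span_induction with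
    | mem b hb =>
      obtain ⟨a, ha, w, rfl⟩ := hb
      rw [Finset.sum_congr rfl fun i _ => hpow i a ha w, ← Finset.sum_smul]
      by_cases hw : χ w = 1
      · exact A.smul_mem (A.mul_mem ha (hA w hw)) _
      · have h1 : (χ w : ℂ) ≠ 1 := fun h => hw (Units.ext h)
        have h2 : (χ w : ℂ) ^ p = 1 := by
          rw [← Units.val_pow_eq_pow_val, ← MonoidHom.pow_apply, hχ, MonoidHom.one_apply,
            Units.val_one]
        rw [geom_sum_eq h1, h2, sub_self, zero_div, zero_smul]
        exact A.zero_mem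
    | zero => simp
    | add b b' _ _ h1 h2 =>
      simp only [map_add, Finset.sum_add_distrib]
      exact A.add_mem h1 h2
    | smul r b _ h1 =>
      simp only [map_smul, ← Finset.smul_sum]
      exact A.smul_mem h1 r
  have hfix : ∀ i : ℕ, (τ ^ i) h = h := fun i => by
    rw [algEquiv_pow_apply (z := 1) (by rw [hh, one_smul]) i, one_pow, one_smul]
  have h1 := havg h
  rw [Finset.sum_congr rfl fun i _ => hfix i, Finset.sum_const, Finset.card_range,
    ← Nat.cast_smul_eq_nsmul ℂ] at h1
  -- The sum over the powers of τ of an invariant h is p h.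
  have h2 := A.smul_mem h1 (p : ℂ)⁻¹
  rwa [smul_smul, inv_mul_cancel₀ (Nat.cast_ne_zero.2 hp), one_smul] at h2

end Twist

end CherednikAlgebra

/-- An element `τ` with `τ ^ p = 1` gives an action of the cyclic group of order `p`. -/
theorem exists_zmod_hom {G : Type*} [Group G] {p : ℕ} [NeZero p] {τ : G} (hτ : τ ^ p = 1) :
    ∃ ρ : Multiplicative (ZMod p) →* G, ρ (.ofAdd 1) = τ ∧ ∀ m, ∃ k : ℕ, ρ m = τ ^ k := by
  let f : ZMod p →+ Additive G := ZMod.lift p ⟨zmultiplesHom (Additive G) (.ofMul τ), by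
    rw [zmultiplesHom_apply, natCast_zsmul, ← ofMul_pow, hτ, ofMul_one]⟩
  have hf : ∀ k : ℤ, f k = k • Additive.ofMul τ := fun k => ZMod.lift_coe _ _ _
  refine ⟨AddMonoidHom.toMultiplicativeLeft f, ?_, fun m => ⟨m.toAdd.val, ?_⟩⟩
  · have := hf 1
    rw [Int.cast_one, one_smul] at this
    exact congrArg Additive.toMul this
  · have := hf m.toAdd.val
    rw [Int.cast_natCast, ZMod.natCast_zmod_val, natCast_zsmul, ← ofMul_pow] at this
    exact congrArg Additive.toMul this

/-- The order of an automorphism which acts through a primitive `p`-th root of unity. -/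
theorem orderOf_eq_of_eigenvector {A : Type*} [Ring A] [Algebra ℂ A] {p : ℕ} {ξ : ℂ}
    (hξ : IsPrimitiveRoot ξ p) {τ : A ≃ₐ[ℂ] A} (hτ : τ ^ p = 1) {a : A} (ha : a ≠ 0)
    (hτa : τ a = ξ • a) : orderOf τ = p := by
  refine Nat.dvd_antisymm (orderOf_dvd_of_pow_eq_one hτ) ?_
  have h := CherednikAlgebra.algEquiv_pow_apply hτa (orderOf τ)
  rw [pow_orderOf_eq_one, AlgEquiv.one_apply] at h
  refine (hξ.pow_eq_one_iff_dvd _).1 (sub_eq_zero.1 ?_)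
  refine (smul_eq_zero_iff_left ha).1 ?_
  rw [sub_smul, one_smul, ← h, sub_self]

namespace CherednikAlgebra

/-- The Cherednik algebra of the kernel of a linear character, embedded in `H_c(W)`, is the algebra
of invariants of the cyclic group generated by the twist. -/
theorem exists_hom_range_eq_invariants {V : Type*} [NormedAddCommGroup V] [InnerProductSpace ℂ V]
    [FiniteDimensional ℂ V] {W W' : Subgroup (V ≃ₗᵢ[ℂ] V)} [Fintype W] [Fintype W']
    (hn : ∀ u ∈ W, ∀ v ∈ W', u * v * u⁻¹ ∈ W') (hle : W' ≤ W) (c : W → ℂ)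
    (hc : ∀ w s : W, IsReflection (s : V ≃ₗᵢ[ℂ] V) → c (w * s * w⁻¹) = c s)
    (hc0 : ∀ s : W, IsReflection (s : V ≃ₗᵢ[ℂ] V) → (s : V ≃ₗᵢ[ℂ] V) ∉ W' → c s = 0)
    {p : ℕ} (hp : p ≠ 0) {χ : W →* ℂˣ} (hχ : χ ^ p = 1)
    (hker : ∀ w : W, χ w = 1 ↔ (w : V ≃ₗᵢ[ℂ] V) ∈ W')
    {τ : CherednikAlgebra W c ≃ₐ[ℂ] CherednikAlgebra W c} (hτx : ∀ f, τ (x W c f) = x W c f)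
    (hτy : ∀ v, τ (y W c v) = y W c v) (hτg : ∀ w, τ (g W c w) = (χ w : ℂ) • g W c w) :
    ∃ ρ : Multiplicative (ZMod p) →* (CherednikAlgebra W c ≃ₐ[ℂ] CherednikAlgebra W c),
      ρ (Multiplicative.ofAdd 1) = τ ∧
    ∃ φ : CherednikAlgebra W' (resParam hle c) →ₐ[ℂ] CherednikAlgebra W c,
      (∀ f, φ (x W' _ f) = x W c f) ∧ (∀ v, φ (y W' _ v) = y W c v) ∧
      (∀ w, φ (g W' _ w) = g W c (Subgroup.inclusion hle w)) ∧ Function.Injective φ ∧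
      ∀ h, h ∈ φ.range ↔ ∀ m, ρ m h = h := by
  have : NeZero p := ⟨hp⟩
  obtain ⟨ρ, hρ1, hρ⟩ := exists_zmod_hom (twist_pow hχ hτx hτy hτg)
  obtain ⟨φ, hφx, hφy, hφg, hφ⟩ := exists_injective_algHom hn hle c hc hc0
  refine ⟨ρ, hρ1, φ, hφx, hφy, hφg, hφ, fun h => ?_⟩
  have hfix : τ.toAlgHom.comp φ = φ := by
    refine algHom_ext (resParam hle c) (fun f => ?_) (fun v => ?_) fun w => ?_
    · change τ (φ _) = φ _
      rw [hφx, hτx]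
    · change τ (φ _) = φ _
      rw [hφy, hτy]
    · change τ (φ _) = φ _
      rw [hφg, hτg, (hker (Subgroup.inclusion hle w)).2 w.2, Units.val_one, one_smul]
  have hinv : h ∈ φ.range ↔ τ h = h :=
    mem_iff_apply_eq c (A := φ.range) (fun f => ⟨_, hφx f⟩) (fun v => ⟨_, hφy v⟩) hp hχ
      (fun w hw => ⟨g _ _ ⟨w, (hker w).1 hw⟩, hφg _⟩)
      (fun _ ⟨a, ha⟩ => ha ▸ DFunLike.congr_fun hfix a) hτg h
  rw [hinv]
  refine ⟨fun hh m => ?_, fun hh => hρ1 ▸ hh _⟩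
  obtain ⟨k, hk⟩ := hρ m
  rw [hk, algEquiv_pow_apply (z := 1) (by rw [hh, one_smul]) k, one_pow, one_smul]

end CherednikAlgebra

end RationalCherednik

end

/-! ### The main theorem. -/

open RationalCherednik CherednikAlgebra in
theorem mainTheorem2 (r p n : ℕ) [NeZero r] [NeZero n] (hp : p ∣ r)
    (ξ : ℂ) (hξ : IsPrimitiveRoot ξ p)
    (c : Gr1 r n → ℂ)
    (hc : ∀ w s : Gr1 r n, IsReflection (s : Cn n ≃ₗᵢ[ℂ] Cn n) → c (w * s * w⁻¹) = c s)
    (hc0 : ∀ s : Gr1 r n, IsReflection (s : Cn n ≃ₗᵢ[ℂ] Cn n) →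
      (s : Cn n ≃ₗᵢ[ℂ] Cn n) ∉ Grp r p n → c s = 0) :
    -- the automorphism of the group algebra
    ∃ τ₀ : MonoidAlgebra ℂ (Gr1 r n) ≃ₐ[ℂ] MonoidAlgebra ℂ (Gr1 r n),
      (∀ σ : MonoidAlgebra ℂ (Gr1 r n) ≃ₐ[ℂ] MonoidAlgebra ℂ (Gr1 r n),
        (σ (MonoidAlgebra.of ℂ _ (S r n 0)) = ξ • MonoidAlgebra.of ℂ _ (S r n 0) ∧
          ∀ k : Fin n, k ≠ 0 →
            σ (MonoidAlgebra.of ℂ _ (S r n k)) = MonoidAlgebra.of ℂ _ (S r n k)) ↔ σ = τ₀) ∧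
      orderOf τ₀ = p ∧
    -- the automorphism of the Cherednik algebra that it induces
    ∃ τ : CherednikAlgebra (Gr1 r n) c ≃ₐ[ℂ] CherednikAlgebra (Gr1 r n) c,
      (∀ σ : CherednikAlgebra (Gr1 r n) c ≃ₐ[ℂ] CherednikAlgebra (Gr1 r n) c,
        ((∀ f, σ (x (Gr1 r n) c f) = x (Gr1 r n) c f) ∧
          (∀ v, σ (y (Gr1 r n) c v) = y (Gr1 r n) c v) ∧
          ∀ a, σ (groupAlg (Gr1 r n) c a) = groupAlg (Gr1 r n) c (τ₀ a)) ↔ σ = τ) ∧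
      orderOf τ = p ∧
    -- the action of the cyclic group of order `p` generated by `τ`, and its invariants
    ∃ ρ : Multiplicative (ZMod p) →*
        (CherednikAlgebra (Gr1 r n) c ≃ₐ[ℂ] CherednikAlgebra (Gr1 r n) c),
      ρ (Multiplicative.ofAdd 1) = τ ∧
    ∃ φ : CherednikAlgebra (Grp r p n) (fun w => c (Subgroup.inclusion (Grp_le r p n) w)) →ₐ[ℂ]
        CherednikAlgebra (Gr1 r n) c,
      (∀ f, φ (x (Grp r p n) _ f) = x (Gr1 r n) c f) ∧
      (∀ v, φ (y (Grp r p n) _ v) = y (Gr1 r n) c v) ∧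
      (∀ w, φ (g (Grp r p n) _ w) = g (Gr1 r n) c (Subgroup.inclusion (Grp_le r p n) w)) ∧
      Function.Injective φ ∧
      ∀ h, h ∈ φ.range ↔ ∀ m, ρ m h = h := by
  let _ : Fintype (Gr1 r n) := Fintype.ofFinite _
  let _ : Fintype (Grp r p n) := Fintype.ofFinite _
  have hp0 : p ≠ 0 := ne_zero_of_dvd_ne_zero (NeZero.ne r) hp
  obtain ⟨χ', hχ0, hχ1, hχker⟩ := exists_character r (n := n) hp hξ
  obtain ⟨χ, hχ⟩ : ∃ χ : Gr1 r n →* ℂˣ, ∀ w, (χ w : ℂ) = χ' w :=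
    ⟨χ'.toHomUnits, fun w => MonoidHom.coe_toHomUnits _ _⟩
  have hker : ∀ w : Gr1 r n, χ w = 1 ↔ (w : Cn n ≃ₗᵢ[ℂ] Cn n) ∈ Grp r p n := fun w => by
    rw [← hχker, ← hχ, Units.val_eq_one]
  have hχp : χ ^ p = 1 := by
    refine MonoidHom.eq_of_eqOn_dense (closure_range_S r) ?_
    rintro _ ⟨k, rfl⟩
    refine Units.ext ?_
    rw [MonoidHom.pow_apply, Units.val_pow_eq_pow_val, hχ, MonoidHom.one_apply, Units.val_one]
    by_cases hk : k = 0
    · rw [hk, hχ0, hξ.pow_eq_one]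
    · rw [hχ1 k hk, one_pow]
  -- Normality holds because G(r,p,n) is a kernel.
  have hn : ∀ u ∈ Gr1 r n, ∀ v ∈ Grp r p n, u * v * u⁻¹ ∈ Grp r p n := by
    intro u hu v hv
    have hv' := Grp_le r p n hv
    refine (hker (⟨u, hu⟩ * ⟨v, hv'⟩ * ⟨u, hu⟩⁻¹)).1 ?_
    rw [map_mul, map_mul, map_inv, (hker ⟨v, hv'⟩).2 hv, mul_one, mul_inv_cancel]
  obtain ⟨τ₀, hτ₀⟩ := exists_groupAlg_twist χ
  have hτ₀p := groupAlg_twist_pow hχp hτ₀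
  obtain ⟨τ, hτx, hτy, hτg⟩ := exists_twist c χ fun w hw h => by
    rw [hker]
    by_contra h1
    exact h (hc0 w hw h1)
  have hτp := twist_pow hχp hτx hτy hτg
  have hgroup : ∀ w, groupAlg (Gr1 r n) c (MonoidAlgebra.of ℂ _ w) = g (Gr1 r n) c w :=
    fun w => MonoidAlgebra.lift_of _ _
  -- Needed only for the order of τ: S_1 must be nonzero to be an eigenvector with eigenvalue ξ.
  have := CherednikAlgebra.nontrivial hc
  refine ⟨τ₀, fun σ => ⟨fun h => ?_, ?_⟩, ?_, τ, fun σ => ⟨fun h => ?_, ?_⟩, ?_, ?_⟩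
  · have h1 : (MonoidAlgebra.lift ℂ _ _).symm σ.toAlgHom =
        (MonoidAlgebra.lift ℂ _ _).symm τ₀.toAlgHom := by
      refine MonoidHom.eq_of_eqOn_dense (closure_range_S r) ?_
      rintro _ ⟨k, rfl⟩
      change σ (MonoidAlgebra.of ℂ _ (S r n k)) = τ₀ (MonoidAlgebra.of ℂ _ (S r n k))
      rw [hτ₀, hχ]
      by_cases hk : k = 0
      · rw [hk, h.1, hχ0]
      · rw [h.2 k hk, hχ1 k hk, one_smul]
    exact AlgEquiv.ext fun a => DFunLike.congr_fun ((MonoidAlgebra.lift ℂ _ _).symm.injective h1) a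
  · rintro rfl
    refine ⟨by rw [hτ₀, hχ, hχ0], fun k hk => by rw [hτ₀, hχ, hχ1 k hk, one_smul]⟩
  · refine orderOf_eq_of_eigenvector hξ hτ₀p (a := MonoidAlgebra.of ℂ _ (S r n 0)) ?_
      (by rw [hτ₀, hχ, hχ0])
    exact MonoidAlgebra.single_ne_zero.2 one_ne_zero
  · refine AlgEquiv.ext fun a => DFunLike.congr_fun (f := σ.toAlgHom) (g := τ.toAlgHom)
      (algHom_ext c (fun f => ?_) (fun v => ?_) fun w => ?_) a
    · exact (h.1 f).trans (hτx f).symm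
    · exact (h.2.1 v).trans (hτy v).symm
    · refine Eq.trans ?_ (hτg w).symm
      have h1 := h.2.2 (MonoidAlgebra.of ℂ _ w)
      rw [hτ₀, map_smul, hgroup] at h1
      exact h1
  · rintro rfl
    refine ⟨hτx, hτy, fun a => ?_⟩
    refine DFunLike.congr_fun (f := σ.toAlgHom.comp (groupAlg (Gr1 r n) c))
      (g := (groupAlg (Gr1 r n) c).comp τ₀.toAlgHom)
      (monoidAlgebra_ext fun w => ?_) a
    change σ (groupAlg (Gr1 r n) c (MonoidAlgebra.of ℂ _ w)) =
      groupAlg (Gr1 r n) c (τ₀ (MonoidAlgebra.of ℂ _ w))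
    rw [hτ₀, map_smul, hgroup, hτg]
  · refine orderOf_eq_of_eigenvector hξ hτp (a := g (Gr1 r n) c (S r n 0)) ?_
      (by rw [hτg, hχ, hχ0])
    exact g_ne_zero c _
  · exact exists_hom_range_eq_invariants hn (Grp_le r p n) c hc hc0 hp0 hχp hker hτx hτy hτg
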